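/- Let $k$ be an infinite field, let $R=k[x_1,\dots,x_s]$ be a standard graded polynomial ring, let $g_1,\dots,g_n\in R$ be $k$-linearly independent homogeneous forms of the same degree $d$, and let $I=(g_1,\dots,g_n)R$. Let $\Psi=[g_1:\dots:g_n]:\mathbb P_k^{s-1}\dashrightarrow\mathbb P_k^{n-1}$ be the rational map defined by these forms, let $A=k[g_1,\dots,g_n]\subset R$ be the homogeneous coordinate ring of its image, and let $B=k[R_d]$ be the $d$-th Veronese subring of $R$, so that $A\subset B$. For a point $p=[\alpha_1:\dots:\alpha_n]$ with coordinates in $k$, the corresponding homogeneous prime ideal $\mathfrak P$ of $k[T_1,\dots,T_n]$ is generated by the homogeneous polynomials vanishing at $\alpha$; if $p$ lies in the image of $\Psi$, then the homogeneous prime ideal of $p$ in $A$ is the image of $\mathfrak P$ under $T_i\mapsto g_i$. For ideals $J,I$ of $R$ put $J:_RI^\infty=\bigcup_{i}(J:_RI^i)$. For a homogeneous ideal $J\subsetneq R$, the multiplicity of $R/J$ is $$e(R/J)=t!\,\lim_{m\to\infty}\frac{\lambda\big(R/(J+\mathfrak m^m)\big)}{m^t},$$ where $\mathfrak m=(x_1,\dots,x_s)$,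 $t=\dim R/J$, and $\lambda$ denotes length. Assume that the Krull dimension of $A$ is $s$. Then the degree $[B:A]=[\operatorname{Quot}(B):\operatorname{Quot}(A)]$ of $\Psi$ is finite, and there exists a dense open subset $U$ of $\mathbb P_k^{s-1}$ such that, for every $k$-rational point $q\in U$, at least one $g_i$ does not vanish at $q$ (so that $\Psi(q)$ is defined) and $$[B:A]=e\big(R/(\mathfrak pR:_RI^\infty)\big),$$ where $\mathfrak p\subset A$ is the homogeneous prime ideal of $\Psi(q)$. That is, the degree of $\Psi$ is the multiplicity of the homogeneous coordinate ring of the fiber $\operatorname{Proj}\big(R/(\mathfrak pR:_RI^\infty)\big)$ of $\Psi$ over $\Psi(q)$. -/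

import Mathlib

open scoped ENNReal Topology

attribute [local instance] MvPolynomial.gradedAlgebra

namespace RationalMapFiber

section Multiplicity

variable {C : Type*} [CommRing C]

/-- The saturation `I : J^∞ = ⋃ i, (I : J^i)` of an ideal `I` with respect to an ideal `J`. -/
def saturation (I J : Ideal C) : Ideal C :=
  ⨆ i : ℕ, Submodule.colon I ((J ^ i : Ideal C) : Set C)

/-- The supremum in the definition of the saturation is a union. -/
theorem mem_saturation {I J : Ideal C} {x : C} :
    x ∈ saturation I J ↔ ∃ i : ℕ, ∀ y ∈ J ^ i, x * y ∈ I := by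
  have hdir : Directed (· ≤ ·) fun i : ℕ => Submodule.colon I ((J ^ i : Ideal C) : Set C) := by
    refine Monotone.directed_le fun a b hab => Submodule.colon_mono le_rfl ?_
    exact Ideal.pow_le_pow_right hab
  rw [saturation, Submodule.mem_iSup_of_directed _ hdir]
  simp [Submodule.mem_colon]

/-- `HasMultiplicity 𝔞 M e`: the multiplicity of the `C`-module `M` with respect to the ideal `𝔞`
exists and equals `e`, that is, `e = s! * lim_{n → ∞} λ(M / 𝔞^n M) / n^s`, where `s` is the Krull
dimension of `M` and `λ` is the length of a `C`-module. -/
def HasMultiplicity (𝔞 : Ideal C) (M : Type*) [AddCommGroup M] [Module C M] (e : ℝ≥0∞) : Prop :=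
  ∃ s : ℕ, Module.supportDim C M = s ∧
    Filter.Tendsto
      (fun n : ℕ => (s.factorial : ℝ≥0∞) *
        ((Module.length C (M ⧸ (𝔞 ^ n • (⊤ : Submodule C M))) : ℝ≥0∞) / (n : ℝ≥0∞) ^ s))
      Filter.atTop (𝓝 e)

end Multiplicity

section Degree

variable {A B : Type*} [CommRing A] [IsDomain A] [CommRing B] [IsDomain B]

/-- The field extension `Quot(A) → Quot(B)` induced by an extension of domains `f : A → B`. -/
noncomputable def quotMap (f : A →+* B) (hf : Function.Injective f) :
    FractionRing A →+* FractionRing B :=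
  IsFractionRing.map hf

/-- The degree `[B : A] = [Quot(B) : Quot(A)]` of an extension of domains `f : A → B`: the
(cardinal) dimension of `Quot(B)` as a vector space over `Quot(A)`. -/
noncomputable def extDegree (f : A →+* B) (hf : Function.Injective f) : Cardinal :=
  letI : Algebra (FractionRing A) (FractionRing B) := (quotMap f hf).toAlgebra
  Module.rank (FractionRing A) (FractionRing B)

end Degree

section Points

variable {k : Type*} [Field k] {m : ℕ}

/-- Restriction of polynomials to the line through the origin and `v`: `f ↦ f(t v) ∈ k[t]`. -/
noncomputable def lineMap (v : Fin m → k) : MvPolynomial (Fin m) k →ₐ[k] Polynomial k :=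
  MvPolynomial.aeval fun i => Polynomial.C (v i) * Polynomial.X

theorem coeff_lineMap (v : Fin m → k) (f : MvPolynomial (Fin m) k) (j : ℕ) :
    (lineMap v f).coeff j =
      MvPolynomial.eval v (MvPolynomial.homogeneousComponent j f) := by
  induction f using MvPolynomial.induction_on' with
  | monomial u a =>
    have h1 : lineMap v (MvPolynomial.monomial u a) =
        Polynomial.C (MvPolynomial.eval v (MvPolynomial.monomial u a)) *
          Polynomial.X ^ u.degree := by
      rw [lineMap, MvPolynomial.aeval_monomial, MvPolynomial.eval_monomial]
      simp only [Finsupp.prod, mul_pow, Finset.prod_mul_distrib, Finset.prod_pow_eq_pow_sum,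
        map_mul, map_prod, map_pow, Finsupp.degree, Polynomial.algebraMap_eq, mul_assoc]
      rfl
    have hm : MvPolynomial.monomial u a ∈
        MvPolynomial.homogeneousSubmodule (Fin m) k u.degree :=
      MvPolynomial.isHomogeneous_monomial a rfl
    rw [h1, MvPolynomial.homogeneousComponent_of_mem hm, Polynomial.coeff_C_mul_X_pow]
    split_ifs <;> simp_all
  | add p q hp hq => simp [hp, hq]

/-- The homogeneous ideal of `k[T_1, …, T_m]` of the point `[v]`: the polynomials which vanish
on the line through the origin and `v` (see `mem_pointIdeal`). -/
noncomputable def pointIdeal (v : Fin m → k) : Ideal (MvPolynomial (Fin m) k) :=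
  RingHom.ker (lineMap v)

/-- The ideal of `[v]` consists of the polynomials all of whose homogeneous components vanish
at `v`. -/
theorem mem_pointIdeal {v : Fin m → k} {f : MvPolynomial (Fin m) k} :
    f ∈ pointIdeal v ↔
      ∀ j : ℕ, MvPolynomial.eval v (MvPolynomial.homogeneousComponent j f) = 0 := by
  rw [pointIdeal, RingHom.mem_ker, Polynomial.ext_iff]
  simp [coeff_lineMap]

theorem pointIdeal_isHomogeneous (v : Fin m → k) :
    (pointIdeal v).IsHomogeneous (MvPolynomial.homogeneousSubmodule (Fin m) k) := by
  intro i f hf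
  rw [mem_pointIdeal] at hf ⊢
  intro j
  have h := MvPolynomial.homogeneousComponent_of_mem (n := i) (m := j)
    (MvPolynomial.homogeneousComponent_mem i f)
  have hd : ((DirectSum.decompose (MvPolynomial.homogeneousSubmodule (Fin m) k) f i :
      MvPolynomial.homogeneousSubmodule (Fin m) k i) : MvPolynomial (Fin m) k) =
      MvPolynomial.homogeneousComponent i f :=
    MvPolynomial.decomposition.decompose'_apply f i
  rw [hd, h]
  split_ifs with hji
  · exact hf i
  · simp

/-- The rational point `[v_1 : … : v_m]` of `ℙ^{m-1} = Proj k[T_1, …, T_m]`, for `v ≠ 0`. -/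
noncomputable def ratPoint (v : Fin m → k) (hv : v ≠ 0) :
    ProjectiveSpectrum (MvPolynomial.homogeneousSubmodule (Fin m) k) where
  asHomogeneousIdeal := ⟨pointIdeal v, pointIdeal_isHomogeneous v⟩
  isPrime := RingHom.ker_isPrime (lineMap v)
  not_irrelevant_le := by
    intro hle
    apply hv
    funext i
    have hX : MvPolynomial.X i ∈
        HomogeneousIdeal.irrelevant (MvPolynomial.homogeneousSubmodule (Fin m) k) := by
      rw [HomogeneousIdeal.mem_irrelevant_iff, GradedRing.proj_apply,
        DirectSum.decompose_of_mem_ne (i := 1) _ (MvPolynomial.isHomogeneous_X k i) one_ne_zero]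
    have h2 : lineMap v (MvPolynomial.X i) = 0 := hle hX
    simpa [lineMap] using h2

end Points

section RationalMap

variable {k : Type*} [Field k] {s n : ℕ}

/-- The homogeneous coordinate ring `A = k[g_1, …, g_n]` of the image of the rational map given by
`g`: the image of `ψ : k[T_1, …, T_n] → R`, `T_i ↦ g_i`. -/
noncomputable def coordRing (g : Fin n → MvPolynomial (Fin s) k) :
    Subalgebra k (MvPolynomial (Fin s) k) :=
  (MvPolynomial.aeval g : MvPolynomial (Fin n) k →ₐ[k] MvPolynomial (Fin s) k).range

/-- The Veronese ring `B = k[R_d]` of `R = k[x_1, …, x_s]`. -/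
noncomputable def veronese (k : Type*) [Field k] (s d : ℕ) :
    Subalgebra k (MvPolynomial (Fin s) k) :=
  Algebra.adjoin k (MvPolynomial.homogeneousSubmodule (Fin s) k d : Set (MvPolynomial (Fin s) k))

theorem coordRing_le_veronese {d : ℕ} {g : Fin n → MvPolynomial (Fin s) k}
    (hg : ∀ i, (g i).IsHomogeneous d) : coordRing g ≤ veronese k s d := by
  rw [coordRing, ← Algebra.adjoin_range_eq_range_aeval]
  refine Algebra.adjoin_mono ?_
  rintro _ ⟨i, rfl⟩
  exact hg i

/-- The degree `[B : A]` of the inclusion of `A = k[g_1, …, g_n]` in `B = k[R_d]`, which is the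
degree of the rational map given by `g`. -/
noncomputable def mapDegree {d : ℕ} (g : Fin n → MvPolynomial (Fin s) k)
    (hg : ∀ i, (g i).IsHomogeneous d) : Cardinal :=
  extDegree (Subalgebra.inclusion (coordRing_le_veronese hg)).toRingHom
    (Subalgebra.inclusion_injective (coordRing_le_veronese hg))

/-- The tuple `(g_1(v), …, g_n(v))`. -/
noncomputable def evalTuple (g : Fin n → MvPolynomial (Fin s) k) (v : Fin s → k) : Fin n → k :=
  fun i => MvPolynomial.eval v (g i)

/-- The value `Ψ([v]) = [g_1(v) : … : g_n(v)] ∈ ℙ^{n-1}` of the rational map given by `g`. -/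
noncomputable def ratMap (g : Fin n → MvPolynomial (Fin s) k) (v : Fin s → k)
    (h : evalTuple g v ≠ 0) :
    ProjectiveSpectrum (MvPolynomial.homogeneousSubmodule (Fin n) k) :=
  ratPoint (evalTuple g v) h

/-- The ideal of `A = k[g_1, …, g_n]` of a point of `ℙ^{n-1}`: the image under `ψ` of the
corresponding homogeneous prime ideal of `k[T_1, …, T_n]`. -/
noncomputable def primeInCoordRing (g : Fin n → MvPolynomial (Fin s) k)
    (p : ProjectiveSpectrum (MvPolynomial.homogeneousSubmodule (Fin n) k)) :
    Ideal (coordRing g) :=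
  p.asHomogeneousIdeal.toIdeal.map (MvPolynomial.aeval g).rangeRestrict

/-- The ideal `𝔭R :_R I^∞`, with `I = (g_1, …, g_n)`, for an ideal `𝔭` of `A`. -/
noncomputable def fiberIdeal (g : Fin n → MvPolynomial (Fin s) k) (𝔭 : Ideal (coordRing g)) :
    Ideal (MvPolynomial (Fin s) k) :=
  saturation (𝔭.map (coordRing g).val) (Ideal.span (Set.range g))

/-- `HasStdMultiplicity J e`: the multiplicity `e(R/J)` of the ring `R/J`, taken with respect to
its maximal homogeneous ideal (the image of `(x_1, …, x_s)`), equals `e`. -/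
def HasStdMultiplicity (J : Ideal (MvPolynomial (Fin s) k)) (e : ℝ≥0∞) : Prop :=
  HasMultiplicity
    ((Ideal.span (Set.range (MvPolynomial.X : Fin s → MvPolynomial (Fin s) k))).map
      (Ideal.Quotient.mk J))
    (MvPolynomial (Fin s) k ⧸ J) e

end RationalMap

end RationalMapFiber

namespace RationalMapFiber

/-! ### Krull dimension and transcendence degree. -/

section Dimension

/-! Since `dim A = s`, the ring `R` is algebraic over `A`, so `Quot(B)` is finite over `Quot(A)`,
with a basis of `r = [B : A]` forms `b i ∈ B` of degrees `d * β i` (`exists_homogeneous_basis`). One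
form `f₂ ∈ A` serves as denominator for all degrees: `f₂ ^ (j + 1)` carries `R_{dj}` into the free
module `N = ⊕ A b i` (`exists_isHomDenom_pow_mul_mem`). Multiply `f₂` by some `g i₀` and by a form
of `A` divisible by a variable `x` to get `f`; the open set is `f ≠ 0`.

Let `f(q) ≠ 0` and let `J` be the fiber ideal. Modulo `𝔭R`, every form of `A` of degree `d * l` is a
scalar multiple of `g i₀ ^ l`, so `J = 𝔭R : (g i₀)^∞`, and `f`, hence also `x`, is a nonzerodivisor
modulo `J`. For large `j` the forms `g i₀ ^ (j - β i) * b i` give a basis of `(R/J)_{dj}`: they span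
because coefficients in `A` reduce to scalars times powers of `g i₀` (`exists_sub_sum_mem`), and
they are independent because elements of `𝔭R` have, up to powers of `f`, coordinates in `𝔭`
(`eq_zero_of_sum_mem`).

Thus the Hilbert function of `R/J` is `r` at large multiples of `d`. Multiplication by `x` makes it
nondecreasing, so it equals `r` in all large degrees. Then `R/J` has dimension one, and its
multiplicity is the limit of the averages of its Hilbert function, which is `r`. -/

theorem ringKrullDim_le_of_isIntegral (A B : Type*) [CommRing A] [CommRing B] [Algebra A B]
    [Algebra.IsIntegral A B] : ringKrullDim B ≤ ringKrullDim A :=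
  Order.krullDim_le_of_strictMono (PrimeSpectrum.comap (algebraMap A B)) fun _ _ h =>
    Ideal.IsIntegral.comap_lt_comap h

/-- A finitely generated subalgebra of `k[x_1, …, x_s]` of Krull dimension `s` has full
transcendence degree. -/
theorem isAlgebraic_of_ringKrullDim_eq {k : Type*} [Field k] {s : ℕ}
    (A : Subalgebra k (MvPolynomial (Fin s) k)) [Algebra.FiniteType k A]
    (hdim : ringKrullDim A = s) : Algebra.IsAlgebraic A (MvPolynomial (Fin s) k) := by
  -- Noether normalization: `A` is integral over a polynomial ring in `e` variables, so `s = dim A ≤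
  -- e`.
  obtain ⟨e, φ, hinj, hint⟩ := exists_integral_inj_algHom_of_fg k A
  have hse : s ≤ e := by
    let := φ.toRingHom.toAlgebra
    have : Algebra.IsIntegral (MvPolynomial (Fin e) k) A := ⟨hint⟩
    have h := ringKrullDim_le_of_isIntegral (MvPolynomial (Fin e) k) A
    rw [hdim, MvPolynomial.ringKrullDim_of_isNoetherianRing, ringKrullDim_eq_zero_of_field] at h
    simpa using h
  let y : Fin e → MvPolynomial (Fin s) k := fun i => A.val (φ (MvPolynomial.X i))
  have hy : MvPolynomial.aeval y = A.val.comp φ := by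
    ext i
    simp [y]
  have hind : AlgebraicIndependent k y := by
    rw [algebraicIndependent_iff_injective_aeval, hy]
    exact Subtype.val_injective.comp hinj
  -- The `e ≥ s = trdeg R` independent elements `y` must form a transcendence basis of `R`, and they
  -- lie in `A`.
  have hle : Cardinal.lift.{0} (Algebra.trdeg k (MvPolynomial (Fin s) k)) ≤
      Cardinal.lift (Cardinal.mk (Fin e)) := by
    rw [MvPolynomial.trdeg_of_isDomain]
    simpa using hse
  have hb := hind.isTranscendenceBasis_of_lift_trdeg_le_of_finite hle
  have := hb.isAlgebraic
  have hsub : Algebra.adjoin k (Set.range y) ≤ A := by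
    refine Algebra.adjoin_le ?_
    rintro _ ⟨i, rfl⟩
    exact (φ _).2
  refine ⟨fun x => ?_⟩
  obtain ⟨p, hp, hpx⟩ := Algebra.IsAlgebraic.isAlgebraic
    (R := Algebra.adjoin k (Set.range y)) x
  refine ⟨p.map (Subalgebra.inclusion hsub).toRingHom, ?_, ?_⟩
  · rwa [Ne, Polynomial.map_eq_zero_iff (Subalgebra.inclusion_injective hsub)]
  · rw [Polynomial.aeval_def, Polynomial.eval₂_map]
    exact hpx

end Dimension

/-! ### Degree of an algebraic extension and bases up to denominators. -/

section Degree

variable {A B : Type*} [CommRing A] [IsDomain A] [CommRing B] [IsDomain B]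

/-- A finitely generated algebraic extension of domains has finite degree `r`, and `r` elements of
any given set of module generators form a basis up to denominators. -/
theorem exists_extDegree_eq [Algebra A B] (hf : Function.Injective (algebraMap A B))
    [Algebra.IsAlgebraic A B] [Algebra.FiniteType A B] (S : Set B)
    (hS : Submodule.span A S = ⊤) :
    ∃ (r : ℕ) (b : Fin r → B), extDegree (algebraMap A B) hf = r ∧ (∀ i, b i ∈ S) ∧
      LinearIndependent A b ∧
      ∀ y : B, ∃ a : A, a ≠ 0 ∧ a • y ∈ Submodule.span A (Set.range b) := by
  let : Algebra (FractionRing A) (FractionRing B) := (quotMap (algebraMap A B) hf).toAlgebra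
  have : IsScalarTower A (FractionRing A) (FractionRing B) := by
    refine IsScalarTower.of_algebraMap_eq fun x => ?_
    rw [RingHom.algebraMap_toAlgebra, quotMap, IsFractionRing.map, IsLocalization.map_eq,
      ← IsScalarTower.algebraMap_apply]
  have hAB : Function.Injective (algebraMap B (FractionRing B)) := IsFractionRing.injective _ _
  have : Algebra.EssFiniteType A (FractionRing B) := by
    have := Algebra.EssFiniteType.of_isLocalization (FractionRing B) (nonZeroDivisors B)
    exact Algebra.EssFiniteType.comp A B (FractionRing B)
  have : Algebra.EssFiniteType (FractionRing A) (FractionRing B) :=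
    Algebra.EssFiniteType.of_comp A _ _
  have : FaithfulSMul A B := (faithfulSMul_iff_algebraMap_injective A B).mpr hf
  have : Algebra.IsAlgebraic (FractionRing A) (FractionRing B) := by
    have : Algebra.IsAlgebraic A (FractionRing B) :=
      (IsFractionRing.isAlgebraic_iff' A B (FractionRing B)).mp inferInstance
    exact Algebra.IsAlgebraic.extendScalars (IsFractionRing.injective A (FractionRing A))
  have : Module.Finite (FractionRing A) (FractionRing B) :=
    Algebra.finite_of_essFiniteType_of_isAlgebraic
  let ι : B →ₗ[A] FractionRing B := (IsScalarTower.toAlgHom A B (FractionRing B)).toLinearMap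
  have htop : Submodule.span (FractionRing A) (ι '' S) = ⊤ :=
    span_eq_top_of_isLocalizedModule (FractionRing A) (nonZeroDivisors A) ι hS
  -- The image of `S` spans the fraction field, so a basis can be chosen inside it.
  obtain ⟨b', hb', hspan, hind⟩ := Submodule.exists_fun_fin_finrank_span_eq (FractionRing A) (ι '' S)
  choose b hbS hb using hb'
  obtain rfl : (fun i => ι (b i)) = b' := funext hb
  refine ⟨_, b, ?_, hbS, ?_, fun y => ?_⟩
  · rw [htop, finrank_top]
    exact (Module.finrank_eq_rank _ _).symm
  · rw [← LinearIndependent.iff_fractionRing A (FractionRing A)] at hind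
    exact LinearIndependent.of_comp ι hind
  · have hy : ι y ∈ Submodule.span (FractionRing A) (Set.range fun i => ι (b i)) := by
      rw [hspan, htop]
      trivial
    obtain ⟨c, hc⟩ := (Submodule.mem_span_range_iff_exists_fun _).mp hy
    obtain ⟨a, ha⟩ := IsLocalization.exist_integer_multiples_of_finite (nonZeroDivisors A) c
    choose e he using ha
    refine ⟨a, nonZeroDivisors.coe_ne_zero a, ?_⟩
    have hsum : (a : A) • y = ∑ i, e i • b i := by
      apply hAB
      change ι ((a : A) • y) = ι (∑ i, e i • b i)
      rw [map_smul, map_sum, ← hc, Finset.smul_sum]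
      refine Finset.sum_congr rfl fun i _ => ?_
      rw [map_smul, ← smul_assoc, ← he, algebraMap_smul]
    rw [hsum]
    exact Submodule.sum_mem _ fun i _ => Submodule.smul_mem _ _ (Submodule.subset_span ⟨i, rfl⟩)

end Degree

/-! ### Homogeneous components of products. -/

section Components

variable {k : Type*} [Field k] {s : ℕ}

open MvPolynomial in
theorem coe_decompose (a : MvPolynomial (Fin s) k) (m : ℕ) :
    ((DirectSum.decompose (homogeneousSubmodule (Fin s) k) a m :
      homogeneousSubmodule (Fin s) k m) : MvPolynomial (Fin s) k) = homogeneousComponent m a :=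
  decomposition.decompose'_apply a m

open MvPolynomial in
theorem homogeneousComponent_mul_of_le {y : MvPolynomial (Fin s) k} {j m : ℕ}
    (hy : y.IsHomogeneous j) (hjm : j ≤ m) (a : MvPolynomial (Fin s) k) :
    homogeneousComponent m (a * y) = homogeneousComponent (m - j) a * y := by
  rw [← coe_decompose, ← coe_decompose]
  exact DirectSum.coe_decompose_mul_of_right_mem_of_le _ hy hjm

open MvPolynomial in
theorem homogeneousComponent_mul_of_not_le {y : MvPolynomial (Fin s) k} {j m : ℕ}
    (hy : y.IsHomogeneous j) (hjm : ¬ j ≤ m) (a : MvPolynomial (Fin s) k) :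
    homogeneousComponent m (a * y) = 0 := by
  rw [← coe_decompose]
  exact DirectSum.coe_decompose_mul_of_right_mem_of_not_le _ hy hjm

open MvPolynomial in
theorem homogeneousComponent_add_mul {y : MvPolynomial (Fin s) k} {j : ℕ}
    (hy : y.IsHomogeneous j) (m : ℕ) (a : MvPolynomial (Fin s) k) :
    homogeneousComponent (m + j) (a * y) = homogeneousComponent m a * y := by
  rw [homogeneousComponent_mul_of_le hy (Nat.le_add_left _ _), Nat.add_sub_cancel]

open MvPolynomial in
theorem exists_homogeneousComponent_ne_zero {a : MvPolynomial (Fin s) k} (ha : a ≠ 0) :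
    ∃ m, homogeneousComponent m a ≠ 0 := by
  by_contra! h
  apply ha
  rw [← sum_homogeneousComponent a]
  exact Finset.sum_eq_zero fun m _ => h m

open MvPolynomial in
theorem lineMap_of_isHomogeneous {a : MvPolynomial (Fin s) k} {m : ℕ} (ha : a.IsHomogeneous m)
    (v : Fin s → k) : lineMap v a = Polynomial.C (eval v a) * Polynomial.X ^ m := by
  ext j
  rw [coeff_lineMap, homogeneousComponent_of_mem ha, Polynomial.coeff_C_mul_X_pow]
  split_ifs <;> simp

end Components

/-! ### Homogeneous denominators in the graded subalgebra `A`. -/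

section GradedSubalgebra

open MvPolynomial

variable {k : Type*} [Field k] {s n d : ℕ} {g : Fin n → MvPolynomial (Fin s) k}

theorem mem_coordRing (i : Fin n) : g i ∈ coordRing g := ⟨X i, by simp⟩

theorem homogeneousComponent_mem_coordRing (hg : ∀ i, (g i).IsHomogeneous d)
    {a : MvPolynomial (Fin s) k} (ha : a ∈ coordRing g) (m : ℕ) :
    homogeneousComponent m a ∈ coordRing g := by
  obtain ⟨F, rfl⟩ := ha
  induction F using MvPolynomial.induction_on' with
  | monomial u c =>
    have h : (MvPolynomial.aeval g (monomial u c)).IsHomogeneous (d * u.degree) :=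
      (isHomogeneous_monomial c rfl).aeval g hg
    change homogeneousComponent m (MvPolynomial.aeval g (monomial u c)) ∈ _
    rw [homogeneousComponent_of_mem h]
    split_ifs
    · exact ⟨_, rfl⟩
    · exact zero_mem _
  | add p q hp hq =>
    rw [map_add, map_add]
    exact add_mem hp hq

theorem homogeneousComponent_coordRing_eq_zero (hg : ∀ i, (g i).IsHomogeneous d)
    {a : MvPolynomial (Fin s) k} (ha : a ∈ coordRing g) {m : ℕ} (hm : ¬ d ∣ m) :
    homogeneousComponent m a = 0 := by
  obtain ⟨F, rfl⟩ := ha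
  induction F using MvPolynomial.induction_on' with
  | monomial u c =>
    have h : (MvPolynomial.aeval g (monomial u c)).IsHomogeneous (d * u.degree) :=
      (isHomogeneous_monomial c rfl).aeval g hg
    change homogeneousComponent m (MvPolynomial.aeval g (monomial u c)) = _
    rw [homogeneousComponent_of_mem h, if_neg]
    rintro rfl
    exact hm (dvd_mul_right _ _)
  | add p q hp hq =>
    rw [map_add, map_add, hp, hq, add_zero]

/-- Nonzero elements of the coordinate ring `A` which are homogeneous of degree a multiple
of `d`. -/
def IsHomDenom (d : ℕ) (g : Fin n → MvPolynomial (Fin s) k) (f : MvPolynomial (Fin s) k) : Prop :=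
  f ∈ coordRing g ∧ f ≠ 0 ∧ ∃ e, f.IsHomogeneous (d * e)

theorem IsHomDenom.mul {f f' : MvPolynomial (Fin s) k} (hf : IsHomDenom d g f)
    (hf' : IsHomDenom d g f') : IsHomDenom d g (f * f') := by
  obtain ⟨h1, h2, e, h3⟩ := hf
  obtain ⟨h1', h2', e', h3'⟩ := hf'
  refine ⟨mul_mem h1 h1', mul_ne_zero h2 h2', e + e', ?_⟩
  rw [mul_add]
  exact h3.mul h3'

theorem isHomDenom_one : IsHomDenom d g 1 :=
  ⟨one_mem _, one_ne_zero, 0, isHomogeneous_one _ _⟩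

/-- A nonzero element of `A` has a nonzero homogeneous component in `A`. -/
theorem exists_isHomDenom_homogeneousComponent (hg : ∀ i, (g i).IsHomogeneous d)
    {a : MvPolynomial (Fin s) k} (ha : a ∈ coordRing g) (ha0 : a ≠ 0) :
    ∃ m, IsHomDenom d g (homogeneousComponent m a) := by
  obtain ⟨m, hm⟩ := exists_homogeneousComponent_ne_zero ha0
  refine ⟨m, homogeneousComponent_mem_coordRing hg ha m, hm, ?_⟩
  have hd : d ∣ m := by
    by_contra h
    exact hm (homogeneousComponent_coordRing_eq_zero hg ha h)
  obtain ⟨e, rfl⟩ := hd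
  exact ⟨e, homogeneousComponent_isHomogeneous _ _⟩

/-- A variable is algebraic over `A`, so it divides a nonzero element of `A`, and therefore every
homogeneous component of that element. This later makes the variable a nonzerodivisor on the
coordinate ring of the fiber. -/
theorem exists_isHomDenom_dvd (hg : ∀ i, (g i).IsHomogeneous d)
    [Algebra.IsAlgebraic (coordRing g) (MvPolynomial (Fin s) k)] (i : Fin s) :
    ∃ f, IsHomDenom d g f ∧ X i ∣ f := by
  obtain ⟨a, ha, c, hc⟩ := (Algebra.IsAlgebraic.isAlgebraic (R := coordRing g)
    (X i : MvPolynomial (Fin s) k)).exists_nonzero_dvd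
    (mem_nonZeroDivisors_of_ne_zero (X_ne_zero i))
  obtain ⟨m, hm⟩ := exists_isHomDenom_homogeneousComponent hg a.2 (by simpa using ha)
  refine ⟨_, hm, ?_⟩
  have hc' : (a : MvPolynomial (Fin s) k) = c * X i := by rw [mul_comm]; exact hc
  rw [hc']
  by_cases h1 : 1 ≤ m
  · rw [homogeneousComponent_mul_of_le (isHomogeneous_X k i) h1]
    exact dvd_mul_left _ _
  · rw [homogeneousComponent_mul_of_not_le (isHomogeneous_X k i) h1]
    exact dvd_zero _

variable {r : ℕ} {b : Fin r → MvPolynomial (Fin s) k} {β : Fin r → ℕ}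

theorem mul_mem_of_mem_coordRing {N : Submodule (coordRing g) (MvPolynomial (Fin s) k)}
    {a y : MvPolynomial (Fin s) k} (ha : a ∈ coordRing g) (hy : y ∈ N) : a * y ∈ N :=
  N.smul_mem ⟨a, ha⟩ hy

theorem homogeneousComponent_mem_span (hg : ∀ i, (g i).IsHomogeneous d)
    (hb : ∀ i, (b i).IsHomogeneous (d * β i)) {y : MvPolynomial (Fin s) k}
    (hy : y ∈ Submodule.span (coordRing g) (Set.range b)) (m : ℕ) :
    homogeneousComponent m y ∈ Submodule.span (coordRing g) (Set.range b) := by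
  obtain ⟨a, rfl⟩ := (Submodule.mem_span_range_iff_exists_fun _).mp hy
  rw [map_sum]
  refine Submodule.sum_mem _ fun i _ => ?_
  have hi : b i ∈ Submodule.span (coordRing g) (Set.range b) := Submodule.subset_span ⟨i, rfl⟩
  rw [Subalgebra.smul_def, smul_eq_mul]
  by_cases h : d * β i ≤ m
  · rw [homogeneousComponent_mul_of_le (hb i) h]
    exact mul_mem_of_mem_coordRing (homogeneousComponent_mem_coordRing hg (a i).2 _) hi
  · rw [homogeneousComponent_mul_of_not_le (hb i) h]
    exact zero_mem _

/-- As `y` is homogeneous and the span is graded, any denominator may be replaced by one of its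
nonzero homogeneous components. -/
theorem exists_isHomDenom_mul_mem (hg : ∀ i, (g i).IsHomogeneous d)
    (hb : ∀ i, (b i).IsHomogeneous (d * β i)) {y : MvPolynomial (Fin s) k} {j : ℕ}
    (hy : y.IsHomogeneous j) {a : MvPolynomial (Fin s) k} (ha : a ∈ coordRing g) (ha0 : a ≠ 0)
    (hay : a * y ∈ Submodule.span (coordRing g) (Set.range b)) :
    ∃ f, IsHomDenom d g f ∧ f * y ∈ Submodule.span (coordRing g) (Set.range b) := by
  obtain ⟨m, hm⟩ := exists_isHomDenom_homogeneousComponent hg ha ha0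
  refine ⟨_, hm, ?_⟩
  rw [← homogeneousComponent_add_mul hy]
  exact homogeneousComponent_mem_span hg hb hay _

theorem exists_isHomDenom_forall_mul_mem {N : Submodule (coordRing g) (MvPolynomial (Fin s) k)}
    (T : Finset (MvPolynomial (Fin s) k)) (hT : ∀ y ∈ T, ∃ f, IsHomDenom d g f ∧ f * y ∈ N) :
    ∃ f, IsHomDenom d g f ∧ ∀ y ∈ T, f * y ∈ N := by
  classical
  induction T using Finset.induction_on with
  | empty => exact ⟨1, isHomDenom_one, by simp⟩
  | insert y T _ ih =>
    obtain ⟨f, hf, hfT⟩ := ih fun z hz => hT z (Finset.mem_insert_of_mem hz)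
    obtain ⟨f', hf', hfy⟩ := hT y (Finset.mem_insert_self _ _)
    refine ⟨f * f', hf.mul hf', fun z hz => ?_⟩
    rcases Finset.mem_insert.mp hz with rfl | hz
    · rw [mul_assoc]
      exact mul_mem_of_mem_coordRing hf.1 hfy
    · rw [mul_comm f, mul_assoc]
      exact mul_mem_of_mem_coordRing hf'.1 (hfT z hz)

theorem homogeneousSubmodule_pow (k : Type*) [Field k] (s d j : ℕ) :
    homogeneousSubmodule (Fin s) k d ^ j = homogeneousSubmodule (Fin s) k (d * j) := by
  rw [← homogeneousSubmodule_one_pow, ← homogeneousSubmodule_one_pow _ (d * j), pow_mul]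

/-- If every form of degree a multiple of `d` is, up to a denominator, an `A`-linear combination
of the `b i`, then one denominator suffices, up to powers. -/
theorem exists_isHomDenom_pow_mul_mem (hg : ∀ i, (g i).IsHomogeneous d)
    (hb : ∀ i, (b i).IsHomogeneous (d * β i))
    (hN : ∀ (y : MvPolynomial (Fin s) k) (j : ℕ), y.IsHomogeneous (d * j) →
      ∃ a ∈ coordRing g, a ≠ 0 ∧ a * y ∈ Submodule.span (coordRing g) (Set.range b)) :
    ∃ f, IsHomDenom d g f ∧ ∀ (j : ℕ) (y : MvPolynomial (Fin s) k), y.IsHomogeneous (d * j) →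
      f ^ (j + 1) * y ∈ Submodule.span (coordRing g) (Set.range b) := by
  classical
  set N := Submodule.span (coordRing g) (Set.range b) with hNdef
  obtain ⟨T, hT⟩ := homogeneousSubmodule_fg (σ := Fin s) (R := k) d
  have hTd : ∀ t ∈ T, t.IsHomogeneous d := fun t ht => by
    have : t ∈ homogeneousSubmodule (Fin s) k d := hT ▸ Submodule.subset_span ht
    exact this
  -- `T` spans `R_d`. The products `t * b i` give `f * R_d * N ⊆ N`, and the element `1` starts the
  -- induction on `j`. Hence the exponent `j + 1`: one factor `f` for `1`, one for each factor from
  -- `R_d`.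
  obtain ⟨f, hf, hfT⟩ := exists_isHomDenom_forall_mul_mem (d := d) (N := N)
    (insert 1 ((T ×ˢ Finset.univ).image fun p => p.1 * b p.2)) (by
      intro y hy
      rcases Finset.mem_insert.mp hy with rfl | hy
      · obtain ⟨a, ha, ha0, hay⟩ := hN 1 0 (isHomogeneous_one _ _)
        exact exists_isHomDenom_mul_mem hg hb (isHomogeneous_one _ _) ha ha0 hay
      · obtain ⟨⟨t, i⟩, hp, rfl⟩ := Finset.mem_image.mp hy
        have ht := (hTd t (Finset.mem_product.mp hp).1).mul (hb i)
        rw [← mul_one_add] at ht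
        obtain ⟨a, ha, ha0, hay⟩ := hN _ _ ht
        exact exists_isHomDenom_mul_mem hg hb ht ha ha0 hay)
  have hstep : ∀ v ∈ homogeneousSubmodule (Fin s) k d, ∀ z ∈ N, f * v * z ∈ N := by
    intro v hv z hz
    rw [← hT] at hv
    obtain ⟨a, rfl⟩ := (Submodule.mem_span_range_iff_exists_fun _).mp hz
    rw [Finset.mul_sum]
    refine Submodule.sum_mem _ fun i _ => ?_
    rw [Subalgebra.smul_def, smul_eq_mul, mul_left_comm]
    refine mul_mem_of_mem_coordRing (a i).2 ?_
    induction hv using Submodule.span_induction with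
    | mem t ht =>
      rw [mul_assoc]
      refine hfT _ (Finset.mem_insert_of_mem (Finset.mem_image.mpr ⟨(t, i), ?_, rfl⟩))
      simpa using ht
    | zero => simp
    | add x y _ _ hx hy =>
      rw [mul_add, add_mul]
      exact add_mem hx hy
    | smul c x _ hx =>
      rw [mul_smul_comm, smul_mul_assoc]
      exact N.smul_of_tower_mem c hx
  refine ⟨f, hf, fun j => ?_⟩
  induction j with
  | zero =>
    intro y hy
    rw [mul_zero, ← totalDegree_zero_iff_isHomogeneous, totalDegree_eq_zero_iff_eq_C] at hy
    rw [hy, mul_comm, ← smul_eq_C_mul, zero_add, pow_one]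
    refine N.smul_of_tower_mem _ ?_
    simpa using hfT 1 (Finset.mem_insert_self _ _)
  | succ j ih =>
    intro y hy
    have hy' : y ∈ homogeneousSubmodule (Fin s) k (d * j) * homogeneousSubmodule (Fin s) k d := by
      rw [← homogeneousSubmodule_pow, ← pow_succ, homogeneousSubmodule_pow]
      exact hy
    clear hy
    induction hy' using Submodule.mul_induction_on' with
    | mem_mul_mem u hu v hv =>
      have := hstep v hv _ (ih u hu)
      convert this using 1
      ring
    | add x _ y _ hx hy =>
      rw [mul_add]
      exact add_mem hx hy

end GradedSubalgebra

/-! ### The fiber ideal and the coordinate ring of the fiber in degrees divisible by `d`. -/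

section Fiber

open MvPolynomial

variable {k : Type*} [Field k] {s n d : ℕ} {g : Fin n → MvPolynomial (Fin s) k}

/-- The ideal of `R` generated by the forms in `A` which vanish at `q`. -/
noncomputable def vanishingIdeal (d : ℕ) (g : Fin n → MvPolynomial (Fin s) k) (q : Fin s → k) :
    Ideal (MvPolynomial (Fin s) k) :=
  Ideal.span {p | p ∈ coordRing g ∧ (∃ l, p.IsHomogeneous (d * l)) ∧ eval q p = 0}

theorem lineMap_aeval (hg : ∀ i, (g i).IsHomogeneous d) (q : Fin s → k)
    (F : MvPolynomial (Fin n) k) :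
    lineMap q (aeval g F) = Polynomial.expand k d (lineMap (evalTuple g q) F) := by
  have h : (lineMap q).comp (aeval g) = (Polynomial.expand k d).comp (lineMap (evalTuple g q)) := by
    ext i : 1
    simp only [AlgHom.comp_apply, aeval_X]
    rw [lineMap_of_isHomogeneous (hg i)]
    simp [lineMap, evalTuple]
  exact DFunLike.congr_fun h F

theorem eval_aeval (q : Fin s → k) (F : MvPolynomial (Fin n) k) :
    eval q (aeval g F) = eval (evalTuple g q) F := by
  induction F using MvPolynomial.induction_on with
  | C a => simp
  | add p q hp hq => rw [map_add, map_add, hp, hq, map_add]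
  | mul_X p i hp => rw [map_mul, map_mul, hp, aeval_X, map_mul, eval_X, evalTuple]

theorem map_primeInCoordRing (hd : d ≠ 0) (hg : ∀ i, (g i).IsHomogeneous d) (q : Fin s → k)
    (h : evalTuple g q ≠ 0) :
    (primeInCoordRing g (ratMap g q h)).map (coordRing g).val = vanishingIdeal d g q := by
  apply le_antisymm
  · refine Ideal.map_le_iff_le_comap.mpr (Ideal.map_le_iff_le_comap.mpr fun F hF => ?_)
    have hF' := mem_pointIdeal.mp (show F ∈ pointIdeal (evalTuple g q) from hF)
    change aeval g F ∈ vanishingIdeal d g q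
    rw [← sum_homogeneousComponent F, map_sum]
    refine Ideal.sum_mem _ fun j _ => Ideal.subset_span ⟨⟨_, rfl⟩, ⟨j, ?_⟩, ?_⟩
    · exact (homogeneousComponent_isHomogeneous j F).aeval g hg
    · rw [eval_aeval, hF']
  · refine Ideal.span_le.mpr ?_
    rintro p ⟨⟨F, rfl⟩, ⟨l, hl⟩, hp⟩
    refine Ideal.mem_map_of_mem (coordRing g).val
      (x := (⟨aeval g F, F, rfl⟩ : coordRing g)) (Ideal.mem_map_of_mem _ (x := F) ?_)
    change lineMap (evalTuple g q) F = 0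
    -- On the line through `q`, `aeval g F` restricts to the restriction of `F` with `t` replaced by
    -- `t ^ d`; for `d > 0` no information is lost.
    apply Polynomial.expand_injective (Nat.pos_of_ne_zero hd)
    rw [← lineMap_aeval hg, map_zero]
    exact (lineMap_of_isHomogeneous hl q).trans (by
      rw [show eval q _ = 0 from hp, map_zero, zero_mul])

theorem vanishingIdeal_le_ker (q : Fin s → k) : vanishingIdeal d g q ≤ pointIdeal q := by
  refine Ideal.span_le.mpr ?_
  rintro p ⟨-, ⟨l, hl⟩, hp⟩
  change lineMap q p = 0
  rw [lineMap_of_isHomogeneous hl, hp, map_zero, zero_mul]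

/-- A property of products with forms in `A` vanishing at `q` that is additive holds on the ideal
which they generate. -/
theorem vanishingIdeal_induction {q : Fin s → k} {Q : MvPolynomial (Fin s) k → Prop} (h0 : Q 0)
    (hadd : ∀ x y, Q x → Q y → Q (x + y))
    (hmul : ∀ (p y : MvPolynomial (Fin s) k) (l : ℕ), p ∈ coordRing g → p.IsHomogeneous (d * l) →
      eval q p = 0 → Q (y * p)) {z : MvPolynomial (Fin s) k} (hz : z ∈ vanishingIdeal d g q) :
    Q z := by
  suffices ∀ y, Q (y * z) by simpa using this 1
  induction hz using Submodule.span_induction with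
  | mem p hp =>
    obtain ⟨h1, ⟨l, h2⟩, h3⟩ := hp
    exact fun y => hmul p y l h1 h2 h3
  | zero => simpa using h0
  | add x y _ _ hx hy =>
    intro z
    rw [mul_add]
    exact hadd _ _ (hx z) (hy z)
  | smul a x _ hx =>
    intro z
    rw [smul_eq_mul, ← mul_assoc]
    exact hx _

theorem homogeneousComponent_mem_vanishingIdeal {q : Fin s → k} {z : MvPolynomial (Fin s) k}
    (hz : z ∈ vanishingIdeal d g q) (m : ℕ) : homogeneousComponent m z ∈ vanishingIdeal d g q := by
  refine vanishingIdeal_induction (Q := fun z => homogeneousComponent m z ∈ vanishingIdeal d g q)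
    (by simp) (fun x y hx hy => by rw [map_add]; exact add_mem hx hy) ?_ hz
  intro p y l h1 h2 h3
  by_cases h : d * l ≤ m
  · rw [homogeneousComponent_mul_of_le h2 h]
    exact Ideal.mul_mem_left _ _ (Ideal.subset_span ⟨h1, ⟨l, h2⟩, h3⟩)
  · rw [homogeneousComponent_mul_of_not_le h2 h]
    exact zero_mem _

/-- Modulo the forms in `A` vanishing at `q`, every form in `A` is a multiple of a power of
`g i₀`, if `g i₀` does not vanish at `q`. -/
theorem sub_mem_vanishingIdeal (hg : ∀ i, (g i).IsHomogeneous d) {q : Fin s → k} {i₀ : Fin n}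
    (hq : eval q (g i₀) ≠ 0) {a : MvPolynomial (Fin s) k} {l : ℕ} (ha : a ∈ coordRing g)
    (hl : a.IsHomogeneous (d * l)) :
    a - C (eval q a / eval q (g i₀) ^ l) * g i₀ ^ l ∈ vanishingIdeal d g q := by
  refine Ideal.subset_span ⟨?_, ⟨l, ?_⟩, ?_⟩
  · exact sub_mem ha (mul_mem ((coordRing g).algebraMap_mem _) (pow_mem (mem_coordRing i₀) l))
  · exact hl.sub (((hg i₀).pow l).C_mul _)
  · simp [hq]

/-- Modulo `𝔭R` each `g i` is a scalar multiple of `g i₀`, so saturating by `I` amounts to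
saturating by the single form `g i₀`. -/
theorem mem_fiberIdeal (hd : d ≠ 0) (hg : ∀ i, (g i).IsHomogeneous d) {q : Fin s → k}
    {i₀ : Fin n} (hq : eval q (g i₀) ≠ 0) (h : evalTuple g q ≠ 0) {y : MvPolynomial (Fin s) k} :
    y ∈ fiberIdeal g (primeInCoordRing g (ratMap g q h)) ↔
      ∃ N, g i₀ ^ N * y ∈ vanishingIdeal d g q := by
  rw [fiberIdeal, map_primeInCoordRing hd hg, mem_saturation]
  refine exists_congr fun N => ⟨fun hy => ?_, fun hy z hz => ?_⟩
  · rw [mul_comm]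
    exact hy _ (Ideal.pow_mem_pow (Ideal.subset_span (Set.mem_range_self i₀)) N)
  · have hle : Ideal.span (Set.range g) ≤ vanishingIdeal d g q ⊔ Ideal.span {g i₀} := by
      refine Ideal.span_le.mpr ?_
      rintro _ ⟨i, rfl⟩
      have h1 := sub_mem_vanishingIdeal hg hq (l := 1) (mem_coordRing i) (by simpa using hg i)
      rw [← sub_add_cancel (g i) (C (eval q (g i) / eval q (g i₀) ^ 1) * g i₀ ^ 1)]
      refine Ideal.add_mem _ (Ideal.mem_sup_left h1) (Ideal.mem_sup_right ?_)
      rw [pow_one (g i₀)]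
      exact Ideal.mul_mem_left _ _ (Ideal.mem_span_singleton_self _)
    have hz' := Ideal.mem_map_of_mem (Ideal.Quotient.mk (vanishingIdeal d g q))
      (Ideal.pow_right_mono hle N hz)
    rw [Ideal.map_pow, Ideal.map_sup, Ideal.map_quotient_self, bot_sup_eq, Ideal.map_span,
      Set.image_singleton, Ideal.span_singleton_pow, Ideal.mem_span_singleton] at hz'
    obtain ⟨c, hc⟩ := hz'
    rw [← Ideal.Quotient.eq_zero_iff_mem] at hy ⊢
    rw [map_mul, map_pow] at hy
    rw [map_mul, hc, mul_left_comm, ← mul_assoc, hy, zero_mul]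

variable {q : Fin s → k} {i₀ : Fin n} {J : Ideal (MvPolynomial (Fin s) k)}

theorem vanishingIdeal_le_saturation
    (hJ : ∀ y, y ∈ J ↔ ∃ N, g i₀ ^ N * y ∈ vanishingIdeal d g q) : vanishingIdeal d g q ≤ J :=
  fun y hy => (hJ y).mpr ⟨0, by simpa using hy⟩

theorem mem_of_pow_mul_mem (hJ : ∀ y, y ∈ J ↔ ∃ N, g i₀ ^ N * y ∈ vanishingIdeal d g q)
    {y : MvPolynomial (Fin s) k} {M : ℕ} (h : g i₀ ^ M * y ∈ J) : y ∈ J := by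
  obtain ⟨N, hN⟩ := (hJ _).mp h
  exact (hJ y).mpr ⟨N + M, by rwa [pow_add, mul_assoc]⟩

/-- The ideal of `q` is prime, contains `𝔭R` and does not contain `g i₀`. -/
theorem le_pointIdeal (hg : ∀ i, (g i).IsHomogeneous d) (hq : eval q (g i₀) ≠ 0)
    (hJ : ∀ y, y ∈ J ↔ ∃ N, g i₀ ^ N * y ∈ vanishingIdeal d g q) : J ≤ pointIdeal q := by
  intro y hy
  obtain ⟨N, hN⟩ := (hJ y).mp hy
  have h : lineMap q (g i₀ ^ N * y) = 0 := vanishingIdeal_le_ker q hN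
  rw [map_mul, map_pow, lineMap_of_isHomogeneous (hg i₀)] at h
  refine (mul_eq_zero.mp h).resolve_left (pow_ne_zero _ (mul_ne_zero ?_ ?_))
  · simpa using hq
  · exact pow_ne_zero _ Polynomial.X_ne_zero

theorem homogeneousComponent_mem_saturation (hg : ∀ i, (g i).IsHomogeneous d)
    (hJ : ∀ y, y ∈ J ↔ ∃ N, g i₀ ^ N * y ∈ vanishingIdeal d g q)
    {y : MvPolynomial (Fin s) k} (hy : y ∈ J) (m : ℕ) : homogeneousComponent m y ∈ J := by
  obtain ⟨N, hN⟩ := (hJ y).mp hy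
  refine (hJ _).mpr ⟨N, ?_⟩
  rw [mul_comm, ← homogeneousComponent_add_mul ((hg i₀).pow N), mul_comm y]
  exact homogeneousComponent_mem_vanishingIdeal hN _

/-- Modulo `J`, `f` is a nonzero scalar times a power of `g i₀`, and `g i₀` is a nonzerodivisor
modulo the saturation `J`. -/
theorem mem_of_denom_mul_mem (hg : ∀ i, (g i).IsHomogeneous d) (hq : eval q (g i₀) ≠ 0)
    (hJ : ∀ y, y ∈ J ↔ ∃ N, g i₀ ^ N * y ∈ vanishingIdeal d g q)
    {f y : MvPolynomial (Fin s) k} (hf : IsHomDenom d g f) (hfq : eval q f ≠ 0)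
    (h : f * y ∈ J) : y ∈ J := by
  obtain ⟨hfA, -, e, he⟩ := hf
  have h1 := vanishingIdeal_le_saturation hJ (sub_mem_vanishingIdeal hg hq hfA he)
  have h2 := sub_mem h (Ideal.mul_mem_right y _ h1)
  rw [← sub_mul, sub_sub_cancel, mul_assoc] at h2
  refine mem_of_pow_mul_mem hJ (M := e) ?_
  have hc : eval q f / eval q (g i₀) ^ e ≠ 0 := div_ne_zero hfq (pow_ne_zero _ hq)
  have h3 := Ideal.mul_mem_left J (C (eval q f / eval q (g i₀) ^ e)⁻¹) h2
  rwa [← mul_assoc, ← C_mul, inv_mul_cancel₀ hc, C_1, one_mul] at h3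

variable {r : ℕ} {b : Fin r → MvPolynomial (Fin s) k} {β : Fin r → ℕ} {f : MvPolynomial (Fin s) k}

/-- Up to powers of `f`, the components of elements of `𝔭R` of degrees divisible by `d` are
combinations of the `b i` with coefficients in `𝔭`. -/
theorem exists_pow_mul_homogeneousComponent_eq (hf : f ∈ coordRing g)
    (hfN : ∀ (j : ℕ) (y : MvPolynomial (Fin s) k), y.IsHomogeneous (d * j) →
      f ^ (j + 1) * y ∈ Submodule.span (coordRing g) (Set.range b))
    {z : MvPolynomial (Fin s) k} (hz : z ∈ vanishingIdeal d g q) (j : ℕ) :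
    ∃ (M : ℕ) (a : Fin r → coordRing g), (∀ i, lineMap q (a i : MvPolynomial (Fin s) k) = 0) ∧
      f ^ M * homogeneousComponent (d * j) z = ∑ i, a i • b i := by
  refine vanishingIdeal_induction (Q := fun z => ∃ (M : ℕ) (a : Fin r → coordRing g),
    (∀ i, lineMap q (a i : MvPolynomial (Fin s) k) = 0) ∧
      f ^ M * homogeneousComponent (d * j) z = ∑ i, a i • b i) ?_ ?_ ?_ hz
  · exact ⟨0, 0, by simp, by simp⟩
  · rintro x y ⟨M, a, ha, hx⟩ ⟨M', a', ha', hy⟩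
    let F : coordRing g := ⟨f, hf⟩
    -- Bring the two expressions to the common power `f ^ (M + M')`.
    refine ⟨M + M', fun i => F ^ M' * a i + F ^ M * a' i, fun i => ?_, ?_⟩
    · simp [ha i, ha' i]
    · simp only [add_smul, mul_smul, Finset.sum_add_distrib, ← Finset.smul_sum, ← hx, ← hy]
      simp only [Subalgebra.smul_def, smul_eq_mul, SubmonoidClass.coe_pow, map_add, F]
      ring
  · intro p y l hp hpl hpq
    by_cases h : d * l ≤ d * j
    · rw [homogeneousComponent_mul_of_le hpl h, ← Nat.mul_sub]
      obtain ⟨a, ha⟩ := (Submodule.mem_span_range_iff_exists_fun _).mp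
        (hfN (j - l) _ (homogeneousComponent_isHomogeneous (d * (j - l)) y))
      refine ⟨j - l + 1, fun i => ⟨p, hp⟩ * a i, fun i => ?_, ?_⟩
      · simp [lineMap_of_isHomogeneous hpl, hpq]
      · simp only [mul_smul, ← Finset.smul_sum, ha]
        rw [Subalgebra.smul_def, smul_eq_mul]
        ring
    · rw [homogeneousComponent_mul_of_not_le hpl h]
      exact ⟨0, 0, by simp, by simp⟩

/-- After multiplication by powers of `f` and `g i₀`, the sum has coordinates in `𝔭` with respect to
the `b i`. By independence over `A`, each `c i` times powers of `f` and `g i₀` vanishes on the line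
through `q`, where `f` and `g i₀` do not. -/
theorem eq_zero_of_sum_mem (hg : ∀ i, (g i).IsHomogeneous d) (hq : eval q (g i₀) ≠ 0)
    (hJ : ∀ y, y ∈ J ↔ ∃ N, g i₀ ^ N * y ∈ vanishingIdeal d g q)
    (hb : ∀ i, (b i).IsHomogeneous (d * β i)) (hlin : LinearIndependent (coordRing g) b)
    (hf : IsHomDenom d g f) (hfq : eval q f ≠ 0)
    (hfN : ∀ (j : ℕ) (y : MvPolynomial (Fin s) k), y.IsHomogeneous (d * j) →
      f ^ (j + 1) * y ∈ Submodule.span (coordRing g) (Set.range b))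
    {j : ℕ} (hj : ∀ i, β i ≤ j) {c : Fin r → k}
    (hc : ∑ i, C (c i) * (g i₀ ^ (j - β i) * b i) ∈ J) : c = 0 := by
  obtain ⟨N, hN⟩ := (hJ _).mp hc
  have hw : (g i₀ ^ N * ∑ i, C (c i) * (g i₀ ^ (j - β i) * b i)).IsHomogeneous (d * (N + j)) := by
    rw [mul_add]
    refine ((hg i₀).pow N).mul (IsHomogeneous.sum _ _ _ fun i _ => IsHomogeneous.C_mul ?_ _)
    have h := ((hg i₀).pow (j - β i)).mul (hb i)
    rwa [← mul_add, Nat.sub_add_cancel (hj i)] at h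
  obtain ⟨M, a, ha, h⟩ := exists_pow_mul_homogeneousComponent_eq hf.1 hfN hN (N + j)
  rw [homogeneousComponent_eq_self hw] at h
  let F : coordRing g := ⟨f, hf.1⟩
  let G : coordRing g := ⟨g i₀, mem_coordRing i₀⟩
  have h' : ∑ i, (F ^ M * G ^ N * algebraMap k _ (c i) * G ^ (j - β i)) • b i = ∑ i, a i • b i := by
    rw [← h, Finset.mul_sum, Finset.mul_sum]
    refine Finset.sum_congr rfl fun i _ => ?_
    rw [Subalgebra.smul_def, smul_eq_mul]
    change f ^ M * g i₀ ^ N * C (c i) * g i₀ ^ (j - β i) * b i = _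
    ring
  funext i
  have hi := Fintype.linearIndependent_iffₛ.mp hlin _ _ h' i
  have hi' := (congrArg (fun x : coordRing g => lineMap q (x : MvPolynomial (Fin s) k)) hi).trans
    (ha i)
  obtain ⟨e, he⟩ := hf.2.2
  change lineMap q (f ^ M * g i₀ ^ N * C (c i) * g i₀ ^ (j - β i)) = 0 at hi'
  have hC : lineMap q (C (c i)) = Polynomial.C (c i) := (lineMap q).commutes (c i)
  have hg0 : Polynomial.C (eval q (g i₀)) * Polynomial.X ^ d ≠ 0 :=
    mul_ne_zero (by simpa using hq) (pow_ne_zero _ Polynomial.X_ne_zero)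
  have hf0 : Polynomial.C (eval q f) * Polynomial.X ^ (d * e) ≠ 0 :=
    mul_ne_zero (by simpa using hfq) (pow_ne_zero _ Polynomial.X_ne_zero)
  rw [map_mul, map_mul, map_mul, map_pow, map_pow, map_pow, hC, lineMap_of_isHomogeneous (hg i₀),
    lineMap_of_isHomogeneous he] at hi'
  have h1 := (mul_eq_zero.mp hi').resolve_right (pow_ne_zero _ hg0)
  have h2 := (mul_eq_zero.mp h1).resolve_left (mul_ne_zero (pow_ne_zero _ hf0) (pow_ne_zero _ hg0))
  simpa using h2

/-- Write `f ^ (j + 1) * y = ∑ a i • b i`. Modulo `J` the relevant component of `a i` is `v i * g i₀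
^ (E + j - β i)`, and `f ^ (j + 1)` is `u * g i₀ ^ E`. Dividing by `u` gives the scalars `u⁻¹ * v
i`, and the factor `f ^ (j + 1)` cancels modulo `J`. -/
theorem exists_sub_sum_mem (hg : ∀ i, (g i).IsHomogeneous d) (hq : eval q (g i₀) ≠ 0)
    (hJ : ∀ y, y ∈ J ↔ ∃ N, g i₀ ^ N * y ∈ vanishingIdeal d g q)
    (hb : ∀ i, (b i).IsHomogeneous (d * β i))
    (hf : IsHomDenom d g f) (hfq : eval q f ≠ 0)
    (hfN : ∀ (j : ℕ) (y : MvPolynomial (Fin s) k), y.IsHomogeneous (d * j) →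
      f ^ (j + 1) * y ∈ Submodule.span (coordRing g) (Set.range b))
    {j : ℕ} (hj : ∀ i, β i ≤ j) {y : MvPolynomial (Fin s) k} (hy : y.IsHomogeneous (d * j)) :
    ∃ c : Fin r → k, y - ∑ i, C (c i) * (g i₀ ^ (j - β i) * b i) ∈ J := by
  obtain ⟨a, ha⟩ := (Submodule.mem_span_range_iff_exists_fun _).mp (hfN j y hy)
  have hfJ : ∀ {z}, f ^ (j + 1) * z ∈ J → z ∈ J := by
    intro z hz
    generalize j + 1 = M at hz
    induction M with
    | zero => simpa using hz
    | succ M ih =>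
      rw [pow_succ', mul_assoc] at hz
      exact ih (mem_of_denom_mul_mem hg hq hJ hf hfq hz)
  obtain ⟨hfA, -, e, he⟩ := hf
  set E := e * (j + 1) with hE
  have hfE : (f ^ (j + 1)).IsHomogeneous (d * E) := by
    rw [hE, ← mul_assoc]
    exact he.pow _
  -- The left side is homogeneous of degree `d * (E + j)`, so only one component of each coefficient
  -- contributes.
  have hcomp : f ^ (j + 1) * y =
      ∑ i, homogeneousComponent (d * (E + j - β i)) (a i : MvPolynomial (Fin s) k) * b i := by
    have h := hfE.mul hy
    rw [← mul_add] at h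
    rw [← homogeneousComponent_eq_self h, ← ha, map_sum]
    refine Finset.sum_congr rfl fun i _ => ?_
    have hi : d * β i ≤ d * (E + j) := Nat.mul_le_mul_left d ((hj i).trans (Nat.le_add_left _ _))
    rw [Subalgebra.smul_def, smul_eq_mul, homogeneousComponent_mul_of_le (hb i) hi, Nat.mul_sub]
  have hle := vanishingIdeal_le_saturation hJ
  have hfE' := hle (sub_mem_vanishingIdeal hg hq (pow_mem hfA (j + 1)) hfE)
  set u := eval q (f ^ (j + 1)) / eval q (g i₀) ^ E with hu
  have hu0 : u ≠ 0 := div_ne_zero (by simpa using fun h => absurd h hfq) (pow_ne_zero _ hq)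
  have hai := fun i => hle (sub_mem_vanishingIdeal hg hq
    (homogeneousComponent_mem_coordRing hg (a i).2 (d * (E + j - β i)))
    (homogeneousComponent_isHomogeneous _ _))
  set v : Fin r → k := fun i => eval q (homogeneousComponent (d * (E + j - β i))
    (a i : MvPolynomial (Fin s) k)) / eval q (g i₀) ^ (E + j - β i) with hv
  refine ⟨fun i => u⁻¹ * v i, hfJ ?_⟩
  rw [mul_sub, hcomp]
  have hsum : ∑ i, C (v i) * g i₀ ^ (E + j - β i) * b i =
      C u * g i₀ ^ E * ∑ i, C (u⁻¹ * v i) * (g i₀ ^ (j - β i) * b i) := by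
    rw [Finset.mul_sum]
    refine Finset.sum_congr rfl fun i _ => ?_
    rw [Nat.add_sub_assoc (hj i), pow_add, C_mul]
    have hC : (C u : MvPolynomial (Fin s) k) * C u⁻¹ = 1 := by
      rw [← C_mul, mul_inv_cancel₀ hu0, C_1]
    linear_combination (-C (v i) * g i₀ ^ E * g i₀ ^ (j - β i) * b i) * hC
  have h1 : ∑ i, homogeneousComponent (d * (E + j - β i)) (a i : MvPolynomial (Fin s) k) * b i -
      ∑ i, C (v i) * g i₀ ^ (E + j - β i) * b i ∈ J := by
    rw [← Finset.sum_sub_distrib]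
    refine Ideal.sum_mem _ fun i _ => ?_
    rw [← sub_mul]
    exact Ideal.mul_mem_right _ _ (hai i)
  have h2 := Ideal.mul_mem_right (∑ i, C (u⁻¹ * v i) * (g i₀ ^ (j - β i) * b i)) _ hfE'
  rw [hsum] at h1
  have h3 := sub_mem h1 h2
  convert h3 using 1
  ring

end Fiber

/-! ### Length over a ring that acts through a field. -/

section Length

/-- If the ring `C` acts on `M` through scalars of the field `k`, then the length of `M` over `C` is
its length over `k`. -/
theorem length_eq_of_forall_exists_smul_eq (k C M : Type*) [Field k] [CommRing C] [Algebra k C]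
    [AddCommGroup M] [Module k M] [Module C M] [IsScalarTower k C M]
    (h : ∀ c : C, ∃ a : k, ∀ m : M, c • m = a • m) : Module.length C M = Module.length k M := by
  let e : Submodule C M ≃o Submodule k M :=
    { toFun := fun p => p.restrictScalars k
      invFun := fun p =>
        { p with
          smul_mem' := fun c m hm => by
            obtain ⟨a, ha⟩ := h c
            rw [ha]
            exact p.smul_mem a hm }
      left_inv := fun p => rfl
      right_inv := fun p => rfl
      map_rel_iff' := Iff.rfl }
  apply WithBot.coe_injective
  rw [Module.coe_length, Module.coe_length, Order.krullDim_eq_of_orderIso e]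

end Length

/-! ### Multiplicity from the Hilbert function. -/

section Hilbert

open MvPolynomial

variable {k : Type*} [Field k] {s : ℕ} (J : Ideal (MvPolynomial (Fin s) k))

/-- The homogeneous component of degree `m` of `R/J`. -/
noncomputable def quotientComponent (m : ℕ) : Submodule k (MvPolynomial (Fin s) k ⧸ J) :=
  (homogeneousSubmodule (Fin s) k m).map (Ideal.Quotient.mkₐ k J).toLinearMap

instance (m : ℕ) : Module.Finite k (quotientComponent J m) :=
  Module.Finite.iff_fg.mpr ((homogeneousSubmodule_fg _ _ m).map _)

/-- The maximal homogeneous ideal of `R/J`. -/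
noncomputable abbrev quotientIrrelevant : Ideal (MvPolynomial (Fin s) k ⧸ J) :=
  (Ideal.span (Set.range (X : Fin s → MvPolynomial (Fin s) k))).map (Ideal.Quotient.mk J)

variable {J}

theorem mk_mem_quotientIrrelevant_pow {y : MvPolynomial (Fin s) k} {m : ℕ} :
    Ideal.Quotient.mk J y ∈ quotientIrrelevant J ^ m ↔
      ∃ y' ∈ idealOfVars (Fin s) k ^ m, y - y' ∈ J := by
  rw [quotientIrrelevant, ← Ideal.map_pow,
    Ideal.mem_map_iff_of_surjective _ Ideal.Quotient.mk_surjective]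
  refine exists_congr fun y' => and_congr_right fun _ => ?_
  rw [eq_comm, Ideal.Quotient.eq]

theorem homogeneousComponent_eq_zero_of_mem {y : MvPolynomial (Fin s) k} {m : ℕ}
    (hy : y ∈ idealOfVars (Fin s) k ^ (m + 1)) : homogeneousComponent m y = 0 := by
  ext u
  rw [coeff_homogeneousComponent, coeff_zero]
  split_ifs with h
  · exact (mem_pow_idealOfVars_iff' _ _).mp hy u (by omega)
  · rfl

theorem mem_pow_idealOfVars_of_isHomogeneous {y : MvPolynomial (Fin s) k} {m : ℕ}
    (hy : y.IsHomogeneous m) : y ∈ idealOfVars (Fin s) k ^ m := by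
  rw [mem_pow_idealOfVars_iff']
  intro u hu
  exact hy.coeff_eq_zero hu.ne

theorem sub_homogeneousComponent_mem {y : MvPolynomial (Fin s) k} {m : ℕ}
    (hy : y ∈ idealOfVars (Fin s) k ^ m) :
    y - homogeneousComponent m y ∈ idealOfVars (Fin s) k ^ (m + 1) := by
  rw [mem_pow_idealOfVars_iff'] at hy ⊢
  intro u hu
  rw [coeff_sub, coeff_homogeneousComponent]
  split_ifs with h
  · exact sub_self _
  · rw [hy u (by omega), sub_zero]

/-- The difference is the length of `𝔪 ^ m / 𝔪 ^ (m + 1)`, which is the degree `m` component of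
`R/J` because `J` is homogeneous. -/
theorem length_quotient_pow_succ (hJ : ∀ y ∈ J, ∀ m, homogeneousComponent m y ∈ J) (m : ℕ) :
    Module.length (MvPolynomial (Fin s) k ⧸ J)
        ((MvPolynomial (Fin s) k ⧸ J) ⧸ quotientIrrelevant J ^ (m + 1)) =
      Module.length (MvPolynomial (Fin s) k ⧸ J)
        ((MvPolynomial (Fin s) k ⧸ J) ⧸ quotientIrrelevant J ^ m) +
      Module.finrank k (quotientComponent J m) := by
  set D := MvPolynomial (Fin s) k ⧸ J
  set 𝔪 := quotientIrrelevant J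
  have hle : 𝔪 ^ (m + 1) ≤ 𝔪 ^ m := Ideal.pow_le_pow_right (Nat.le_succ m)
  let π : (D ⧸ 𝔪 ^ (m + 1)) →ₗ[D] (D ⧸ 𝔪 ^ m) := Submodule.factor hle
  have hπ : Function.Surjective π := Submodule.factor_surjective hle
  rw [Module.length_eq_add_of_exact (LinearMap.ker π).subtype π (Submodule.subtype_injective _) hπ
    (LinearMap.exact_subtype_ker_map π), add_comm]
  congr 1
  have hmem : ∀ c : D, Submodule.Quotient.mk c ∈ LinearMap.ker π ↔ c ∈ 𝔪 ^ m := fun c => by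
    rw [LinearMap.mem_ker]
    exact Submodule.Quotient.mk_eq_zero _
  rw [length_eq_of_forall_exists_smul_eq k]
  · let φ : quotientComponent J m →ₗ[k] LinearMap.ker π :=
      { toFun := fun c => ⟨Submodule.Quotient.mk c, (hmem _).mpr (by
          obtain ⟨c, y, hy, rfl⟩ := c
          exact mk_mem_quotientIrrelevant_pow.mpr
            ⟨y, mem_pow_idealOfVars_of_isHomogeneous hy, by simp⟩)⟩
        map_add' := fun _ _ => rfl
        map_smul' := fun _ _ => rfl }
    have hφ : Function.Bijective φ := by
      constructor
      · rw [← LinearMap.ker_eq_bot, LinearMap.ker_eq_bot']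
        rintro ⟨c, y, hy, rfl⟩ h
        have h1 : (Submodule.Quotient.mk (Ideal.Quotient.mk J y) : D ⧸ 𝔪 ^ (m + 1)) = 0 :=
          congrArg Subtype.val h
        rw [Submodule.Quotient.mk_eq_zero] at h1
        obtain ⟨y', hy', hyy⟩ := mk_mem_quotientIrrelevant_pow.mp h1
        have h2 := hJ _ hyy m
        rw [map_sub, homogeneousComponent_eq_zero_of_mem hy', sub_zero,
          homogeneousComponent_eq_self hy] at h2
        exact Subtype.ext (Ideal.Quotient.eq_zero_iff_mem.mpr h2)
      · rintro ⟨z, hz⟩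
        obtain ⟨c, rfl⟩ := Submodule.Quotient.mk_surjective _ z
        obtain ⟨y, rfl⟩ := Ideal.Quotient.mk_surjective c
        obtain ⟨y', hy', hyy⟩ := mk_mem_quotientIrrelevant_pow.mp ((hmem _).mp hz)
        refine ⟨⟨_, homogeneousComponent m y', homogeneousComponent_isHomogeneous _ _, rfl⟩,
          Subtype.ext ?_⟩
        change (Submodule.Quotient.mk (Ideal.Quotient.mk J (homogeneousComponent m y')) :
          D ⧸ 𝔪 ^ (m + 1)) = Submodule.Quotient.mk (Ideal.Quotient.mk J y)
        rw [← Ideal.Quotient.eq.mpr hyy |>.symm, eq_comm, Submodule.Quotient.eq, ← map_sub]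
        exact mk_mem_quotientIrrelevant_pow.mpr
          ⟨_, sub_homogeneousComponent_mem hy', by simp⟩
    let e := LinearEquiv.ofBijective φ hφ
    rw [← e.length_eq, Module.length_eq_finrank]
  · intro c
    obtain ⟨y, rfl⟩ := Ideal.Quotient.mk_surjective c
    -- `y` minus its constant term lies in the irrelevant ideal, which annihilates `𝔪 ^ m / 𝔪 ^ (m +
    -- 1)`.
    refine ⟨coeff 0 y, ?_⟩
    rintro ⟨z, hz⟩
    obtain ⟨c, rfl⟩ := Submodule.Quotient.mk_surjective _ z
    apply Subtype.ext
    change (Submodule.Quotient.mk (Ideal.Quotient.mk J y * c) : D ⧸ 𝔪 ^ (m + 1)) =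
      Submodule.Quotient.mk (coeff 0 y • c)
    have hsmul : (coeff 0 y • c : D) = Ideal.Quotient.mk J (C (coeff 0 y)) * c := by
      obtain ⟨c, rfl⟩ := Ideal.Quotient.mk_surjective c
      rw [← map_mul, ← smul_eq_C_mul]
      rfl
    rw [Submodule.Quotient.eq, hsmul, ← sub_mul,
      show 𝔪 ^ (m + 1) = 𝔪 * 𝔪 ^ m from pow_succ' 𝔪 m]
    refine Ideal.mul_mem_mul ?_ ((hmem c).mp hz)
    rw [← map_sub, ← pow_one 𝔪]
    refine mk_mem_quotientIrrelevant_pow.mpr ⟨y - C (coeff 0 y), ?_, by simp⟩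
    rw [mem_pow_idealOfVars_iff']
    intro u hu
    obtain rfl : u = 0 := (Finsupp.degree_eq_zero_iff u).mp (by omega)
    simp

theorem length_quotient_pow (hJ : ∀ y ∈ J, ∀ m, homogeneousComponent m y ∈ J) (m : ℕ) :
    Module.length (MvPolynomial (Fin s) k ⧸ J)
        ((MvPolynomial (Fin s) k ⧸ J) ⧸ quotientIrrelevant J ^ m) =
      (∑ i ∈ Finset.range m, Module.finrank k (quotientComponent J i) : ℕ) := by
  induction m with
  | zero =>
    rw [Finset.range_zero, Finset.sum_empty, Nat.cast_zero, Module.length_eq_zero_iff]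
    exact Submodule.Quotient.subsingleton_iff.mpr ((pow_zero (quotientIrrelevant J)).trans Ideal.one_eq_top)
  | succ m ih => rw [length_quotient_pow_succ hJ, ih, Finset.sum_range_succ, Nat.cast_add]

/-- In dimension one the normalized length is the average of the first values of the Hilbert
function, so it converges to the eventual value by Cesàro's theorem. -/
theorem hasStdMultiplicity_of_eventually (hJ : ∀ y ∈ J, ∀ m, homogeneousComponent m y ∈ J)
    (hdim : ringKrullDim (MvPolynomial (Fin s) k ⧸ J) = 1) {r m₀ : ℕ}
    (hr : ∀ m ≥ m₀, Module.finrank k (quotientComponent J m) = r) :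
    HasStdMultiplicity J r := by
  refine ⟨1, ?_, ?_⟩
  · rw [Module.supportDim_self_eq_ringKrullDim, hdim]
    rfl
  · have h1 : Filter.Tendsto (fun i => (Module.finrank k (quotientComponent J i) : ℝ))
        Filter.atTop (𝓝 r) := by
      refine tendsto_const_nhds.congr' ?_
      filter_upwards [Filter.eventually_ge_atTop m₀] with i hi
      rw [hr i hi]
    have h2 := ENNReal.tendsto_ofReal h1.cesaro
    rw [ENNReal.ofReal_natCast] at h2
    refine h2.congr' ?_
    filter_upwards [Filter.eventually_gt_atTop 0] with m hm
    have hl := length_quotient_pow hJ m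
    rw [← (Submodule.quotEquivOfEq (quotientIrrelevant J ^ m • ⊤) (quotientIrrelevant J ^ m)
      (by rw [smul_eq_mul, Ideal.mul_top])).length_eq] at hl
    rw [hl, ENat.toENNReal_coe, Nat.factorial_one, Nat.cast_one, one_mul, pow_one,
      ← Nat.cast_sum, inv_mul_eq_div, ENNReal.ofReal_div_of_pos (by exact_mod_cast hm),
      ENNReal.ofReal_natCast, ENNReal.ofReal_natCast]

end Hilbert

/-! ### Stabilization of the Hilbert function, and dimension one. -/

section HilbertStabilization

open MvPolynomial

variable {k : Type*} [Field k] {s : ℕ} {J : Ideal (MvPolynomial (Fin s) k)}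

theorem mk_mem_quotientComponent {y : MvPolynomial (Fin s) k} {m : ℕ} (hy : y.IsHomogeneous m) :
    Ideal.Quotient.mk J y ∈ quotientComponent J m :=
  ⟨y, hy, rfl⟩

variable (J) in
/-- Multiplication by the variable `X x` on `R/J`, from degree `m` to degree `m + 1`. -/
noncomputable def mulX (x : Fin s) (m : ℕ) :
    quotientComponent J m →ₗ[k] quotientComponent J (m + 1) :=
  (LinearMap.mulLeft k (Ideal.Quotient.mk J (X x))).restrict (by
    rintro _ ⟨y, hy, rfl⟩
    have h := (isHomogeneous_X k x).mul hy
    rw [add_comm] at h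
    exact ⟨_, h, map_mul (Ideal.Quotient.mk J) _ _⟩)

theorem coe_mulX (x : Fin s) (m : ℕ) (c : quotientComponent J m) :
    (mulX J x m c : MvPolynomial (Fin s) k ⧸ J) = Ideal.Quotient.mk J (X x) * c := rfl

variable {x : Fin s}

theorem mulX_injective (hx : ∀ y, X x * y ∈ J → y ∈ J) (m : ℕ) :
    Function.Injective (mulX J x m) := by
  rw [← LinearMap.ker_eq_bot, LinearMap.ker_eq_bot']
  rintro ⟨c, y, hy, rfl⟩ h
  have h1 : Ideal.Quotient.mk J (X x * y) = 0 := by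
    rw [map_mul]
    exact congrArg Subtype.val h
  exact Subtype.ext (Ideal.Quotient.eq_zero_iff_mem.mpr
    (hx y (Ideal.Quotient.eq_zero_iff_mem.mp h1)))

theorem finrank_quotientComponent_mono (hx : ∀ y, X x * y ∈ J → y ∈ J) :
    Monotone fun m => Module.finrank k (quotientComponent J m) :=
  monotone_nat_of_le_succ fun m =>
    LinearMap.finrank_le_finrank_of_injective (mulX_injective hx m)

theorem finrank_quotientComponent_eq {r m : ℕ} {w : Fin r → MvPolynomial (Fin s) k}
    (hw : ∀ i, (w i).IsHomogeneous m) (hind : ∀ c : Fin r → k, ∑ i, C (c i) * w i ∈ J → c = 0)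
    (hspan : ∀ y : MvPolynomial (Fin s) k, y.IsHomogeneous m →
      ∃ c : Fin r → k, y - ∑ i, C (c i) * w i ∈ J) :
    Module.finrank k (quotientComponent J m) = r := by
  let φ : (Fin r → k) →ₗ[k] quotientComponent J m :=
    Fintype.linearCombination k fun i => ⟨Ideal.Quotient.mk J (w i), mk_mem_quotientComponent (hw i)⟩
  have hφ : ∀ c, (φ c : MvPolynomial (Fin s) k ⧸ J) =
      Ideal.Quotient.mk J (∑ i, C (c i) * w i) := by
    intro c
    rw [map_sum, Fintype.linearCombination_apply, AddSubmonoidClass.coe_finsetSum]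
    refine Finset.sum_congr rfl fun i _ => ?_
    rw [← smul_eq_C_mul]
    rfl
  have hbij : Function.Bijective φ := by
    constructor
    · rw [← LinearMap.ker_eq_bot, LinearMap.ker_eq_bot']
      intro c hc
      apply hind
      rw [← Ideal.Quotient.eq_zero_iff_mem, ← hφ, hc]
      rfl
    · rintro ⟨_, y, hy, rfl⟩
      obtain ⟨c, hc⟩ := hspan y hy
      refine ⟨c, Subtype.ext ?_⟩
      rw [hφ]
      exact (Ideal.Quotient.eq.mpr hc).symm
  rw [← (LinearEquiv.ofBijective φ hbij).finrank_eq, Module.finrank_fin_fun]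

/-- For the nondecreasing Hilbert function `H`, `r = H(d * j₀) ≤ H(m) ≤ H(d * m) = r`. -/
theorem finrank_quotientComponent_eq_of_multiples (hx : ∀ y, X x * y ∈ J → y ∈ J) {r d j₀ : ℕ}
    (hd : d ≠ 0) (hr : ∀ j ≥ j₀, Module.finrank k (quotientComponent J (d * j)) = r) (m : ℕ)
    (hm : d * j₀ ≤ m) : Module.finrank k (quotientComponent J m) = r := by
  have h1 := Nat.le_mul_of_pos_left m (Nat.pos_of_ne_zero hd)
  have h2 := Nat.le_mul_of_pos_left j₀ (Nat.pos_of_ne_zero hd)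
  apply le_antisymm
  · rw [← hr m (h2.trans hm)]
    exact finrank_quotientComponent_mono hx h1
  · rw [← hr j₀ le_rfl]
    exact finrank_quotientComponent_mono hx hm

theorem iSup_quotientComponent (c : MvPolynomial (Fin s) k ⧸ J) :
    c ∈ ⨆ m, quotientComponent J m := by
  obtain ⟨y, rfl⟩ := Ideal.Quotient.mk_surjective c
  rw [← sum_homogeneousComponent y, map_sum]
  exact Submodule.sum_mem _ fun m _ => Submodule.mem_iSup_of_mem m
    (mk_mem_quotientComponent (homogeneousComponent_isHomogeneous _ _))

/-- Multiplication by `x` is injective between components of equal finite dimension from degree `m₀`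
on, hence bijective there. So `R/J` is generated over `k[x]` by its components of degree at most
`m₀`, and is finite over a ring of dimension one. -/
theorem ringKrullDim_quotient_le_one (hx : ∀ y, X x * y ∈ J → y ∈ J) {r m₀ : ℕ}
    (hr : ∀ m ≥ m₀, Module.finrank k (quotientComponent J m) = r) :
    ringKrullDim (MvPolynomial (Fin s) k ⧸ J) ≤ 1 := by
  let φ : Polynomial k →ₐ[k] MvPolynomial (Fin s) k ⧸ J :=
    Polynomial.aeval (Ideal.Quotient.mk J (X x))
  let : Algebra (Polynomial k) (MvPolynomial (Fin s) k ⧸ J) := φ.toRingHom.toAlgebra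
  have : IsScalarTower k (Polynomial k) (MvPolynomial (Fin s) k ⧸ J) :=
    IsScalarTower.of_algebraMap_eq fun a => (φ.commutes a).symm
  let N : Submodule (Polynomial k) (MvPolynomial (Fin s) k ⧸ J) :=
    ⨆ i ∈ Finset.range (m₀ + 1),
      Submodule.span (Polynomial k) (quotientComponent J i : Set (MvPolynomial (Fin s) k ⧸ J))
  have hfg : N.FG := by
    refine Submodule.fg_biSup _ _ fun i _ => ?_
    obtain ⟨T, hT⟩ : (quotientComponent J i).FG := Module.Finite.iff_fg.mp inferInstance
    rw [← hT, Submodule.span_span_of_tower]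
    exact ⟨T, rfl⟩
  have hle : ∀ m, ∀ c ∈ quotientComponent J m, c ∈ N := by
    intro m
    induction m with
    | zero =>
      exact fun c hc => Submodule.mem_iSup_of_mem 0 (Submodule.mem_iSup_of_mem (by simp)
        (Submodule.subset_span hc))
    | succ m ih =>
      intro c hc
      by_cases hm : m + 1 ≤ m₀
      · exact Submodule.mem_iSup_of_mem (m + 1) (Submodule.mem_iSup_of_mem
          (by simpa [Nat.lt_succ_iff] using hm) (Submodule.subset_span hc))
      · have hsurj : Function.Surjective (mulX J x m) :=
          (LinearMap.injective_iff_surjective_of_finrank_eq_finrank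
            ((hr m (by omega)).trans (hr (m + 1) (by omega)).symm)).mp (mulX_injective hx m)
        obtain ⟨c', hc'⟩ := hsurj ⟨c, hc⟩
        have h1 : c = (Polynomial.X : Polynomial k) • (c' : MvPolynomial (Fin s) k ⧸ J) := by
          rw [Algebra.smul_def]
          change c = φ Polynomial.X * _
          rw [Polynomial.aeval_X, ← coe_mulX, hc']
        rw [h1]
        exact N.smul_mem _ (ih _ c'.2)
  have htop : N = ⊤ := by
    rw [eq_top_iff]
    intro c _
    have h : (⨆ m, quotientComponent J m) ≤ N.restrictScalars k := iSup_le hle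
    exact h (iSup_quotientComponent c)
  have : Module.Finite (Polynomial k) (MvPolynomial (Fin s) k ⧸ J) := ⟨htop ▸ hfg⟩
  refine (ringKrullDim_le_of_isIntegral (Polynomial k) _).trans ?_
  rw [Polynomial.ringKrullDim_of_isNoetherianRing, ringKrullDim_eq_zero_of_field, zero_add]

/-- Restriction to the line through `q ≠ 0` maps `R/J` onto `k[t]`. -/
theorem one_le_ringKrullDim_quotient {q : Fin s → k} (hq : q ≠ 0) (hJ : J ≤ pointIdeal q) :
    1 ≤ ringKrullDim (MvPolynomial (Fin s) k ⧸ J) := by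
  obtain ⟨i, hi⟩ := Function.ne_iff.mp hq
  have hi : q i ≠ 0 := hi
  have hsurj : Function.Surjective (Ideal.Quotient.lift J (lineMap q).toRingHom fun a ha => hJ ha) := by
    apply Ideal.Quotient.lift_surjective_of_surjective
    intro p
    refine ⟨Polynomial.aeval (C (q i)⁻¹ * X i) p, ?_⟩
    change lineMap q (Polynomial.aeval (C (q i)⁻¹ * X i) p) = p
    have h : lineMap q (C (q i)⁻¹ * X i) = Polynomial.X := by
      rw [lineMap_of_isHomogeneous (isHomogeneous_C_mul_X _ _)]
      simp [hi]
    rw [← Polynomial.aeval_algHom_apply, h, Polynomial.aeval_X_left_apply]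
  have h := ringKrullDim_le_of_surjective _ hsurj
  rwa [Polynomial.ringKrullDim_of_isNoetherianRing, ringKrullDim_eq_zero_of_field, zero_add] at h

end HilbertStabilization

/-! ### The Veronese ring and a homogeneous basis over `A`. -/

section Veronese

open MvPolynomial

variable {k : Type*} [Field k] {s n d : ℕ} {g : Fin n → MvPolynomial (Fin s) k}

theorem mem_veronese {y : MvPolynomial (Fin s) k} {j : ℕ} (hy : y.IsHomogeneous (d * j)) :
    y ∈ veronese k s d := by
  have h : homogeneousSubmodule (Fin s) k d ^ j ≤ Subalgebra.toSubmodule (veronese k s d) := by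
    induction j generalizing y with
    | zero => simp
    | succ j ih =>
      rw [pow_succ]
      refine Submodule.mul_le.mpr fun u hu v hv => ?_
      have hu' : u ∈ veronese k s d :=
        ih (y := u) (by rw [homogeneousSubmodule_pow] at hu; exact hu) hu
      exact (veronese k s d).mul_mem hu' (Algebra.subset_adjoin hv)
  rw [homogeneousSubmodule_pow] at h
  exact h hy

theorem mem_span_of_mem_veronese {y : MvPolynomial (Fin s) k} (hy : y ∈ veronese k s d) :
    y ∈ Submodule.span k {z : MvPolynomial (Fin s) k | ∃ j, z.IsHomogeneous (d * j)} := by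
  rw [veronese, ← Subalgebra.mem_toSubmodule, Algebra.adjoin_eq_span] at hy
  refine Submodule.span_mono ?_ hy
  intro z hz
  induction hz using Submonoid.closure_induction with
  | mem z hz => exact ⟨1, by rw [mul_one]; exact hz⟩
  | one => exact ⟨0, isHomogeneous_one _ _⟩
  | mul u v _ _ hu hv =>
    obtain ⟨i, hi⟩ := hu
    obtain ⟨j, hj⟩ := hv
    exact ⟨i + j, by rw [mul_add]; exact hi.mul hj⟩

instance (g : Fin n → MvPolynomial (Fin s) k) : Algebra.FiniteType k (coordRing g) :=
  Algebra.FiniteType.of_surjective (aeval g : MvPolynomial (Fin n) k →ₐ[k] _).rangeRestrict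
    (AlgHom.rangeRestrict_surjective _)

instance : Algebra.FiniteType k (veronese k s d) := by
  obtain ⟨T, hT⟩ := homogeneousSubmodule_fg (Fin s) k d
  rw [← Subalgebra.fg_iff_finiteType]
  refine ⟨T, ?_⟩
  rw [veronese, ← hT, Algebra.adjoin_span]

/-- The degree of the map is the length of a homogeneous basis of the Veronese ring over the
coordinate ring, up to denominators. -/
theorem exists_homogeneous_basis (hg : ∀ i, (g i).IsHomogeneous d)
    [Algebra.IsAlgebraic (coordRing g) (MvPolynomial (Fin s) k)] :
    ∃ (r : ℕ) (b : Fin r → MvPolynomial (Fin s) k) (β : Fin r → ℕ), mapDegree g hg = r ∧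
      (∀ i, (b i).IsHomogeneous (d * β i)) ∧ LinearIndependent (coordRing g) b ∧
      ∀ (y : MvPolynomial (Fin s) k) (j : ℕ), y.IsHomogeneous (d * j) →
        ∃ a ∈ coordRing g, a ≠ 0 ∧ a * y ∈ Submodule.span (coordRing g) (Set.range b) := by
  let : Algebra (coordRing g) (veronese k s d) :=
    (Subalgebra.inclusion (coordRing_le_veronese hg)).toRingHom.toAlgebra
  have : IsScalarTower (coordRing g) (veronese k s d) (MvPolynomial (Fin s) k) :=
    IsScalarTower.of_algebraMap_eq fun _ => rfl
  have : IsScalarTower k (coordRing g) (veronese k s d) :=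
    IsScalarTower.of_algebraMap_eq fun _ => rfl
  have : Algebra.FiniteType (coordRing g) (veronese k s d) :=
    Algebra.FiniteType.of_restrictScalars_finiteType k _ _
  have : Algebra.IsAlgebraic (coordRing g) (veronese k s d) :=
    Algebra.IsAlgebraic.tower_bot_of_injective (A := MvPolynomial (Fin s) k) Subtype.val_injective
  let S : Set (veronese k s d) := {y | ∃ j, (y : MvPolynomial (Fin s) k).IsHomogeneous (d * j)}
  have hS : Submodule.span (coordRing g) S = ⊤ := by
    rw [eq_top_iff]
    rintro ⟨y, hy⟩ -
    have key : ∀ z ∈ Submodule.span k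
        {z : MvPolynomial (Fin s) k | ∃ j, z.IsHomogeneous (d * j)},
        ∃ h : z ∈ veronese k s d, (⟨z, h⟩ : veronese k s d) ∈ Submodule.span (coordRing g) S := by
      intro z hz
      induction hz using Submodule.span_induction with
      | mem z hz => exact ⟨mem_veronese hz.choose_spec, Submodule.subset_span hz⟩
      | zero => exact ⟨zero_mem _, zero_mem _⟩
      | add u v _ _ hu hv =>
        obtain ⟨hu, hu'⟩ := hu
        obtain ⟨hv, hv'⟩ := hv
        exact ⟨add_mem hu hv, add_mem hu' hv'⟩
      | smul c u _ hu =>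
        obtain ⟨hu, hu'⟩ := hu
        exact ⟨Subalgebra.smul_mem _ hu c, Submodule.smul_of_tower_mem _ c hu'⟩
    exact (key y (mem_span_of_mem_veronese hy)).2
  obtain ⟨r, b, hr, hbS, hind, hspan⟩ := exists_extDegree_eq
    (A := coordRing g) (B := veronese k s d)
    (Subalgebra.inclusion_injective (coordRing_le_veronese hg)) S hS
  choose β hβ using hbS
  let ι : veronese k s d →ₗ[coordRing g] MvPolynomial (Fin s) k :=
    (IsScalarTower.toAlgHom (coordRing g) (veronese k s d) (MvPolynomial (Fin s) k)).toLinearMap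
  refine ⟨r, fun i => b i, β, hr, hβ, ?_, fun y j hy => ?_⟩
  · exact hind.map' ι (LinearMap.ker_eq_bot.mpr Subtype.val_injective)
  · obtain ⟨a, ha, hay⟩ := hspan ⟨y, mem_veronese hy⟩
    refine ⟨a, a.2, by simpa using ha, ?_⟩
    have h := Submodule.mem_map_of_mem (f := ι) hay
    rw [Submodule.map_span, ← Set.range_comp] at h
    exact h

end Veronese

/-! ### The dense open set and the conclusion. -/

section Main

open MvPolynomial

variable {k : Type*} [Field k] {s n d : ℕ} {g : Fin n → MvPolynomial (Fin s) k}

/-- The zero ideal is a point of `Proj` because there is a variable `x`. This generic point lies in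
every nonempty open set and in `f ≠ 0`. -/
theorem dense_basicOpen (x : Fin s) {f : MvPolynomial (Fin s) k} (hf : f ≠ 0) :
    Dense (ProjectiveSpectrum.basicOpen (homogeneousSubmodule (Fin s) k) f :
      Set (ProjectiveSpectrum (homogeneousSubmodule (Fin s) k))) := by
  let η : ProjectiveSpectrum (homogeneousSubmodule (Fin s) k) :=
    { asHomogeneousIdeal := ⊥
      isPrime := by
        rw [HomogeneousIdeal.toIdeal_bot]
        exact Ideal.isPrime_bot
      not_irrelevant_le := by
        intro hle
        have hX : X x ∈ HomogeneousIdeal.irrelevant (homogeneousSubmodule (Fin s) k) := by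
          rw [HomogeneousIdeal.mem_irrelevant_iff, GradedRing.proj_apply,
            DirectSum.decompose_of_mem_ne (i := 1) _ (isHomogeneous_X k x) one_ne_zero]
        exact X_ne_zero x (Ideal.mem_bot.mp (hle hX)) }
  rw [dense_iff_inter_open]
  rintro V hV ⟨p, hp⟩
  refine ⟨η, ?_, fun h => hf (Ideal.mem_bot.mp h)⟩
  by_contra hη
  obtain ⟨S, hS⟩ := (ProjectiveSpectrum.isOpen_iff _ V).mp hV
  have h1 : η ∈ ProjectiveSpectrum.zeroLocus (homogeneousSubmodule (Fin s) k) S := hS ▸ hη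
  have h2 : p ∈ Vᶜ := by
    rw [hS]
    intro z hz
    have hz0 : z = 0 := Ideal.mem_bot.mp (h1 hz)
    rw [hz0]
    exact zero_mem p.asHomogeneousIdeal.toIdeal
  exact h2 hp

/-- The open set where `f ≠ 0` works, for a suitable denominator `f`. -/
theorem hasStdMultiplicity_fiberIdeal (hd : d ≠ 0) (hg : ∀ i, (g i).IsHomogeneous d) {r : ℕ}
    {b : Fin r → MvPolynomial (Fin s) k} {β : Fin r → ℕ}
    (hb : ∀ i, (b i).IsHomogeneous (d * β i)) (hlin : LinearIndependent (coordRing g) b)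
    {f : MvPolynomial (Fin s) k} (hf : IsHomDenom d g f)
    (hfN : ∀ (j : ℕ) (y : MvPolynomial (Fin s) k), y.IsHomogeneous (d * j) →
      f ^ (j + 1) * y ∈ Submodule.span (coordRing g) (Set.range b))
    {x : Fin s} (hfx : X x ∣ f) {i₀ : Fin n} {q : Fin s → k} (hq : q ≠ 0) (hfq : eval q f ≠ 0)
    (hgq : eval q (g i₀) ≠ 0) (h : evalTuple g q ≠ 0) :
    HasStdMultiplicity (fiberIdeal g (primeInCoordRing g (ratMap g q h))) r := by
  have hJ := fun y => mem_fiberIdeal hd hg hgq h (y := y)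
  set J := fiberIdeal g (primeInCoordRing g (ratMap g q h))
  have hx : ∀ y, X x * y ∈ J → y ∈ J := by
    intro y hy
    obtain ⟨c, rfl⟩ := hfx
    apply mem_of_denom_mul_mem hg hgq hJ hf hfq
    rw [mul_comm (X x), mul_assoc]
    exact Ideal.mul_mem_left _ _ hy
  have hr : ∀ j ≥ ∑ i, β i, Module.finrank k (quotientComponent J (d * j)) = r := by
    intro j hj
    have hj' : ∀ i, β i ≤ j := fun i =>
      (Finset.single_le_sum (f := β) (fun _ _ => Nat.zero_le _) (Finset.mem_univ i)).trans hj
    refine finrank_quotientComponent_eq (w := fun i => g i₀ ^ (j - β i) * b i) (fun i => ?_)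
      (fun c hc => eq_zero_of_sum_mem hg hgq hJ hb hlin hf hfq hfN hj' hc)
      (fun y hy => exists_sub_sum_mem hg hgq hJ hb hf hfq hfN hj' hy)
    have h := ((hg i₀).pow (j - β i)).mul (hb i)
    rwa [← mul_add, Nat.sub_add_cancel (hj' i)] at h
  have hr' := finrank_quotientComponent_eq_of_multiples hx hd hr
  exact hasStdMultiplicity_of_eventually
    (fun y hy m => homogeneousComponent_mem_saturation hg hJ hy m)
    (le_antisymm (ringKrullDim_quotient_le_one hx hr')
      (one_le_ringKrullDim_quotient hq (le_pointIdeal hg hgq hJ))) hr'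

/-- Evaluation at the origin shows that a constant divisible by a variable is zero. This excludes `d
= 0` and `n = 0` in the main theorem. -/
theorem not_isHomDenom_of_forall_eq_C {f : MvPolynomial (Fin s) k} {x : Fin s}
    (hf : IsHomDenom d g f) (hfx : X x ∣ f) (c : k) : f ≠ C c := by
  rintro rfl
  obtain ⟨e, he⟩ := hfx
  have h := congrArg (eval (0 : Fin s → k)) he
  rw [eval_C, map_mul, eval_X, Pi.zero_apply, zero_mul] at h
  exact hf.2.1 (by rw [h, C_0])

end Main

end RationalMapFiber

open RationalMapFiber in
theorem mainTheorem10 {k : Type*} [Field k] [Infinite k] (s n d : ℕ)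
    (g : Fin n → MvPolynomial (Fin s) k)
    (hg : ∀ i, (g i).IsHomogeneous d)
    (hlin : LinearIndependent k g)
    (hdim : ringKrullDim (RationalMapFiber.coordRing g) = s) :
    ∃ r : ℕ, RationalMapFiber.mapDegree g hg = r ∧
      ∃ U : TopologicalSpace.Opens
          (ProjectiveSpectrum (MvPolynomial.homogeneousSubmodule (Fin s) k)),
        Dense (U : Set (ProjectiveSpectrum (MvPolynomial.homogeneousSubmodule (Fin s) k))) ∧
        ∀ (q : Fin s → k) (hq : q ≠ 0), RationalMapFiber.ratPoint q hq ∈ U →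
          ∃ h : RationalMapFiber.evalTuple g q ≠ 0,
            RationalMapFiber.HasStdMultiplicity
              (RationalMapFiber.fiberIdeal g
                (RationalMapFiber.primeInCoordRing g (RationalMapFiber.ratMap g q h)))
              (r : ENNReal) := by
  have := isAlgebraic_of_ringKrullDim_eq (coordRing g) hdim
  obtain ⟨r, b, β, hr, hb, hind, hspan⟩ := exists_homogeneous_basis hg
  refine ⟨r, hr, ?_⟩
  -- Without variables there is no `q ≠ 0`, so the condition on points is vacuous.
  rcases isEmpty_or_nonempty (Fin s) with hs | ⟨⟨x⟩⟩
  · exact ⟨⊤, by simp, fun q hq => absurd (Subsingleton.elim q 0) hq⟩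
  obtain ⟨f₁, hf₁, hxf⟩ := exists_isHomDenom_dvd hg x
  have hd : d ≠ 0 := by
    rintro rfl
    obtain ⟨e, he⟩ := hf₁.2.2
    rw [zero_mul, ← MvPolynomial.totalDegree_zero_iff_isHomogeneous,
      MvPolynomial.totalDegree_eq_zero_iff_eq_C] at he
    exact not_isHomDenom_of_forall_eq_C hf₁ hxf _ he
  have hn : Nonempty (Fin n) := by
    by_contra hn
    rw [not_nonempty_iff] at hn
    obtain ⟨F, hF⟩ := hf₁.1
    refine not_isHomDenom_of_forall_eq_C hf₁ hxf (F.coeff 0) ?_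
    rw [← hF, MvPolynomial.eq_C_of_isEmpty F]
    simp
  obtain ⟨i₀⟩ := hn
  obtain ⟨f₂, hf₂, hf₂N⟩ := exists_isHomDenom_pow_mul_mem hg hb hspan
  have hg₀ : IsHomDenom d g (g i₀) :=
    ⟨mem_coordRing i₀, hlin.ne_zero i₀, 1, by rw [mul_one]; exact hg i₀⟩
  -- Nonvanishing at `q` of the three factors makes `x` a nonzerodivisor on the fiber, `Ψ(q)`
  -- defined, and the `b i` usable as a basis.
  have hf := (hf₁.mul hg₀).mul hf₂
  refine ⟨ProjectiveSpectrum.basicOpen _ (f₁ * g i₀ * f₂), dense_basicOpen x hf.2.1,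
    fun q hq hqU => ?_⟩
  have hfq : MvPolynomial.eval q (f₁ * g i₀ * f₂) ≠ 0 := by
    intro h0
    refine hqU ?_
    obtain ⟨e, he⟩ := hf.2.2
    change lineMap q _ = 0
    rw [lineMap_of_isHomogeneous he, h0, map_zero, zero_mul]
  have hgq : MvPolynomial.eval q (g i₀) ≠ 0 := by
    rw [map_mul, map_mul] at hfq
    exact right_ne_zero_of_mul (left_ne_zero_of_mul hfq)
  have h : evalTuple g q ≠ 0 := fun h0 => hgq (congrFun h0 i₀)
  refine ⟨h, hasStdMultiplicity_fiberIdeal hd hg hb hind hf (fun j y hy => ?_)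
    ((hxf.mul_right _).mul_right _) hq hfq hgq h⟩
  -- The extra factors of the denominator lie in `A`, so they preserve the span of the `b i`.
  rw [mul_pow, mul_assoc]
  exact mul_mem_of_mem_coordRing (pow_mem (hf₁.mul hg₀).1 _) (hf₂N j y hy)
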